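/- Let $D=\left(\frac{-1,-1}{\mathbb Q}\right)$ be the Hamilton quaternion algebra over $\mathbb Q$, with $k=ij$ and $\rho=\frac12(1+i+j+k)$, and let $\mathcal A=\mathbb Z\oplus\mathbb Z i\oplus\mathbb Z j\oplus\mathbb Z\rho$ be the Hurwitz order; write $\mathcal A(R)=\mathcal A\otimes_{\mathbb Z}R$. Let $\mathfrak m_2$ be the maximal ideal, generated by $i-j$, of the maximal order $\mathcal A(\mathbb Z_2)$ of $D\otimes\mathbb Q_2$, and put $U^2=1+\mathfrak m_2^2$. For an odd prime $p$ let $$A_p=\{x\in\mathcal A : \mathrm{Nrd}(x)=p \text{ and } x \text{ has trivial image in } (D\otimes\mathbb Q_2)^\times/(\mathbb Q_2^\times U^2)\},$$ and let $PA_p$ be the image of $A_p$ in $D^\times/\mathbb Q^\times$, where $x\mapsto[x]$ denotes the quotient map. Let $S$ be a finite set of places of $\mathbb Q$ containing $\{2,\infty\}$, let $S_0=S\setminus\{2,\infty\}$, let $\Lambda_S=\mathcal A(\mathbb Z_S)^\times/\mathbb Z_S^\times\subseteq D^\times/\mathbb Q^\times$, where $\mathbb Z_S$ is $\mathbb Z$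 with the primes in $S$ inverted, and let $\Gamma_S\subseteq\Lambda_S$ be the subgroup generated by $\bigcup_{p\in S_0}PA_p$. For $p\in S_0$ let $T_{p+1}$ be the Bruhat–Tits tree of $(D\otimes\mathbb Q_p)^\times/\mathbb Q_p^\times\cong \mathrm{PGL}_2(\mathbb Q_p)$, and let $\Gamma_S$ act on the cube complex $\prod_{p\in S_0}T_{p+1}$ through the maps $D^\times/\mathbb Q^\times\to(D\otimes\mathbb Q_p)^\times/\mathbb Q_p^\times$. (1) There are unique permutations $\sigma^\ell_x$ of $PA_\ell$, for all $p\neq\ell$ in $S_0$ and $x\in PA_p$, such that $x\cdot\sigma^\ell_x(y)=y\cdot\sigma^p_y(x)$ for all $p\ne\ell$ in $S_0$, $x\in PA_p$ and $y\in PA_\ell$. With these permutations, $\Gamma_S$ is presented by the generators $\bigcup_{p\in S_0}PA_p$ subject to the relations (i) $[x_0+x_1i+x_2j+x_3k]\cdot[x_0-x_1i-x_2j-x_3k]=1$ for all $p\in S_0$ and $[x_0+x_1i+x_2j+x_3k]\in PA_p$; (ii) $x\cdot\sigma^\ell_x(y)=y\cdot\sigma^p_y(x)$ for all $p\neq\ell$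 in $S_0$, $x\in PA_p$ and $y\in PA_\ell$. (2) If $p\equiv1\bmod 4$ for all $p\in S_0$, or $p\equiv\pm1\bmod 8$ for all $p\in S_0$, then no element of $\Gamma_S$ other than $1$ maps a cell of $\prod_{p\in S_0}T_{p+1}$ onto itself. In particular $\Gamma_S$ is torsion-free. -/

import Mathlib

open scoped Quaternion

noncomputable section

namespace HurwitzLattice

/-- The quaternion `a + b i + c j + d k`. -/
def quat {K : Type*} [Field K] (a b c d : K) : ℍ[K] := QuaternionAlgebra.mk a b c d

section quat_fields

variable {K : Type*} [Field K] (a b c d : K)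

@[simp] theorem quat_re : (quat a b c d).re = a := rfl
@[simp] theorem quat_imI : (quat a b c d).imI = b := rfl
@[simp] theorem quat_imJ : (quat a b c d).imJ = c := rfl
@[simp] theorem quat_imK : (quat a b c d).imK = d := rfl

end quat_fields

/-- The quaternion `a + b i + c j + d ρ`, where `ρ = (1 + i + j + k) / 2`. -/
def hquat {K : Type*} [Field K] (a b c d : K) : ℍ[K] :=
  a • quat 1 0 0 0 + b • quat 0 1 0 0 + c • quat 0 0 1 0
    + d • quat (1 / 2) (1 / 2) (1 / 2) (1 / 2)

section hquat_fields

variable {K : Type*} [Field K] (a b c d : K)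

@[simp] theorem hquat_re : (hquat a b c d).re = a + d / 2 := by simp [hquat]; ring
@[simp] theorem hquat_imI : (hquat a b c d).imI = b + d / 2 := by simp [hquat]; ring
@[simp] theorem hquat_imJ : (hquat a b c d).imJ = c + d / 2 := by simp [hquat]; ring
@[simp] theorem hquat_imK : (hquat a b c d).imK = d / 2 := by simp [hquat]; ring

end hquat_fields

/-- The Hurwitz order `R ⊕ R i ⊕ R j ⊕ R ρ`, with `ρ = (1 + i + j + k) / 2`, inside the Hamilton
quaternion algebra over `K`.  For `R ⊆ K` this is `𝒜(R) = 𝒜 ⊗ R`; in particular it is the Hurwitz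
maximal order `𝒜` itself for `R = ℤ`, `K = ℚ`. -/
def hurwitz (R K : Type*) [CommRing R] [Field K] [CharZero K] [Algebra R K] : Subring ℍ[K] where
  carrier := {x | ∃ a b c d : R, x =
    hquat (algebraMap R K a) (algebraMap R K b) (algebraMap R K c) (algebraMap R K d)}
  mul_mem' := by
    rintro _ _ ⟨a, b, c, d, rfl⟩ ⟨a', b', c', d', rfl⟩
    refine ⟨a * a' - b * b' - c * c' - d * d' - b * c' + c * b' - b * d' - d * c',
      a * b' + b * a' - b * c' + c * b' + d * b' + c * d' - d * c',
      a * c' + c * a' - b * c' + c * b' - b * d' + d * b' + c * d',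
      a * d' + d * a' + 2 * b * c' - 2 * c * b' + b * d' - d * b' - c * d' + d * c' + d * d',
      ?_⟩
    ext <;> simp only [Quaternion.re_mul, Quaternion.imI_mul, Quaternion.imJ_mul, Quaternion.imK_mul,
      hquat_re, hquat_imI, hquat_imJ, hquat_imK, map_add, map_sub, map_mul, map_ofNat] <;>
      field_simp <;> ring
  one_mem' := ⟨1, 0, 0, 0, by ext <;> simp⟩
  add_mem' := by
    rintro _ _ ⟨a, b, c, d, rfl⟩ ⟨a', b', c', d', rfl⟩
    refine ⟨a + a', b + b', c + c', d + d', ?_⟩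
    ext <;> simp <;> ring
  zero_mem' := ⟨0, 0, 0, 0, by ext <;> simp⟩
  neg_mem' := by
    rintro _ ⟨a, b, c, d, rfl⟩
    refine ⟨-a, -b, -c, -d, ?_⟩
    ext <;> simp <;> ring

/-- The central subgroup `Kˣ` of the unit group of the quaternion algebra over `K`. -/
def scalars (K : Type*) [Field K] : Subgroup ℍ[K]ˣ :=
  (Units.map (algebraMap K ℍ[K] : K →* ℍ[K])).range

instance scalars_normal (K : Type*) [Field K] : (scalars K).Normal where
  conj_mem := by
    rintro _ ⟨q, rfl⟩ g
    refine ⟨q, ?_⟩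
    ext1
    simp only [Units.coe_map, Units.val_mul, MonoidHom.coe_coe]
    rw [← Algebra.commutes, mul_assoc, Units.mul_inv, mul_one]

/-- The projective unit group of the quaternion algebra over `K`: invertible quaternions modulo
invertible scalars. -/
abbrev PGL (K : Type*) [Field K] : Type _ := ℍ[K]ˣ ⧸ scalars K

/-- The class `[u]` of an invertible quaternion modulo scalars. -/
def cls {K : Type*} [Field K] : ℍ[K]ˣ →* PGL K := QuotientGroup.mk' (scalars K)

/-- `𝒜(R)ˣ` modulo scalars, as a subgroup of the projective unit group over `K`. -/
def PGLA (R K : Type*) [CommRing R] [Field K] [CharZero K] [Algebra R K] : Subgroup (PGL K) :=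
  (Units.map ((hurwitz R K).subtype : hurwitz R K →* ℍ[K])).range.map cls

/-- Extension of scalars `D → D ⊗ L` for the Hamilton quaternions. -/
def extend {K : Type*} (L : Type*) [Field K] [Field L] [Algebra K L] : ℍ[K] →+* ℍ[L] where
  toFun x := quat (algebraMap K L x.re) (algebraMap K L x.imI) (algebraMap K L x.imJ)
    (algebraMap K L x.imK)
  map_one' := by ext <;> simp
  map_zero' := by ext <;> simp
  map_add' x y := by ext <;> simp
  map_mul' x y := by ext <;> simp

/-- The localisation map on projective unit groups induced by extension of scalars. -/
def loc {K : Type*} (L : Type*) [Field K] [Field L] [Algebra K L] : PGL K →* PGL L :=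
  QuotientGroup.map (scalars K) (scalars L) (Units.map (extend L : ℍ[K] →+* ℍ[L]).toMonoidHom) (by
    rintro _ ⟨q, rfl⟩
    refine ⟨Units.map (algebraMap K L : K →* L) q, ?_⟩
    ext1
    ext <;> simp [extend])

/-! ### The arithmetic groups -/

instance primes_fact (p : Nat.Primes) : Fact (p : ℕ).Prime := ⟨p.2⟩

/-- The prime `2`. -/
def two : Nat.Primes := ⟨2, Nat.prime_two⟩

/-- For the set `S` of finite places, the set `S₀` of unramified places in it: all but `2`. -/
def unram (S : Finset Nat.Primes) : Finset Nat.Primes := S.erase two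

/-- The ring `ℤ_S`, obtained from `ℤ` by inverting the primes in `S`. -/
def ZS (S : Finset Nat.Primes) : Subring ℚ :=
  Subring.closure {q | ∃ p ∈ S, q = (((p : ℕ) : ℚ))⁻¹}

/-- The `S`-arithmetic group `Λ_S = 𝒜(ℤ_S)ˣ / ℤ_Sˣ`, inside `Dˣ / ℚˣ`. -/
def Lam (S : Finset Nat.Primes) : Subgroup (PGL ℚ) := PGLA (ZS S) ℚ

/-- The higher unit group `Uⁿ = 1 + 𝔪₂ⁿ` of the maximal order `𝒜(ℤ₂)` of `D ⊗ ℚ₂`, where the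
maximal ideal `𝔪₂` is generated by `π = i - j`. (The elements are invertible for `n ≥ 1`.) -/
def higherUnits (n : ℕ) : Set ℍ[ℚ_[2]] :=
  {x | ∃ a ∈ hurwitz ℤ_[2] ℚ_[2], x = 1 + quat 0 1 (-1) 0 ^ n * a}

/-- The kernel of `Dˣ → (D ⊗ ℚ₂)ˣ / (ℚ₂ˣ · U²)`. -/
def kerPsi : Set ℍ[ℚ] :=
  {x | ∃ q : ℚ_[2], q ≠ 0 ∧ ∃ u ∈ higherUnits 2, extend ℚ_[2] x = q • u}

/-- The set `A_p` of Hurwitz quaternions of reduced norm `p` with trivial image in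
`(D ⊗ ℚ₂)ˣ / (ℚ₂ˣ · U²)`. -/
def A (p : ℕ) : Set ℍ[ℚ] :=
  {x | x ∈ hurwitz ℤ ℚ ∧ Quaternion.normSq x = (p : ℚ) ∧ x ∈ kerPsi}

/-- The image `PA_p` of `A_p` modulo scalars. -/
def PA (p : ℕ) : Set (PGL ℚ) := {g | ∃ u : ℍ[ℚ]ˣ, (u : ℍ[ℚ]) ∈ A p ∧ cls u = g}

/-- The set `⋃ PA_p`, over all `p ∈ S₀`. -/
def gens (S : Finset Nat.Primes) : Set (PGL ℚ) := ⋃ p ∈ unram S, PA p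

/-- The group `Γ_S` generated by the sets `PA_p`, for `p ∈ S₀`. -/
def Gam (S : Finset Nat.Primes) : Subgroup (PGL ℚ) := Subgroup.closure (gens S)

/-! ### The presentation -/

/-- A generator attached to an element of `PA_p`. -/
def gen {S : Finset Nat.Primes} {p : unram S} (x : PA p.1) : FreeGroup (gens S) :=
  FreeGroup.of ⟨x, Set.mem_biUnion (s := (unram S : Set Nat.Primes)) p.2 x.2⟩

/-- A family of permutations: `σ p ℓ h x` is the permutation of `PA_ℓ` attached to `x ∈ PA_p`. -/
abbrev PermFamily (S : Finset Nat.Primes) : Type _ :=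
  ∀ p l : unram S, p ≠ l → PA p.1 → Equiv.Perm (PA l.1)

/-- The square identities `x · σ_x(y) = y · σ_y(x)` in `Dˣ / ℚˣ`. -/
def IsSquareFamily {S : Finset Nat.Primes} (σ : PermFamily S) : Prop :=
  ∀ (p l : unram S) (h : p ≠ l) (x : PA p.1) (y : PA l.1),
    (x : PGL ℚ) * (σ p l h x y : PGL ℚ) = (y : PGL ℚ) * (σ l p h.symm y x : PGL ℚ)

/-- The inverse relators `[x₀ + x₁ i + x₂ j + x₃ k] · [x₀ - x₁ i - x₂ j - x₃ k]`. -/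
def inverseRelators (S : Finset Nat.Primes) : Set (FreeGroup (gens S)) :=
  {r | ∃ (p : unram S) (x y : PA p.1) (u v : ℍ[ℚ]ˣ), cls u = (x : PGL ℚ) ∧ cls v = (y : PGL ℚ) ∧
    (v : ℍ[ℚ]) = star (u : ℍ[ℚ]) ∧ r = gen x * gen y}

/-- The square relators, expressing `x · σ_x(y) = y · σ_y(x)`. -/
def squareRelators {S : Finset Nat.Primes} (σ : PermFamily S) : Set (FreeGroup (gens S)) :=
  {r | ∃ (p l : unram S) (h : p ≠ l) (x : PA p.1) (y : PA l.1),
    r = (gen x * gen (σ p l h x y)) * (gen y * gen (σ l p h.symm y x))⁻¹}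

/-! ### The product of Bruhat-Tits trees -/

/-- Vertices of the Bruhat-Tits tree at `p`: cosets of the stabiliser `𝒜(ℤ_p)ˣ / ℤ_pˣ` of the
standard vertex in `(D ⊗ ℚ_p)ˣ / ℚ_pˣ ≃ PGL₂(ℚ_p)`.  The group acts by left translation. -/
abbrev TreeVertex (p : ℕ) [Fact p.Prime] : Type := PGL ℚ_[p] ⧸ PGLA ℤ_[p] ℚ_[p]

/-- The classes of elements of `𝒜(ℤ_p)` whose reduced norm is a uniformiser of `ℤ_p`. -/
def primeClasses (p : ℕ) [Fact p.Prime] : Set (PGL ℚ_[p]) :=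
  {g | ∃ u : ℍ[ℚ_[p]]ˣ, (u : ℍ[ℚ_[p]]) ∈ hurwitz ℤ_[p] ℚ_[p] ∧
    ‖Quaternion.normSq (u : ℍ[ℚ_[p]])‖ = (p : ℝ)⁻¹ ∧ cls u = g}

theorem star_mem_hurwitz {R K : Type*} [CommRing R] [Field K] [CharZero K] [Algebra R K]
    {x : ℍ[K]} (hx : x ∈ hurwitz R K) : star x ∈ hurwitz R K := by
  obtain ⟨a, b, c, d, rfl⟩ := hx
  refine ⟨a + d, -b, -c, -d, ?_⟩
  ext <;> simp <;> ring

theorem inv_mem_primeClasses {p : ℕ} [Fact p.Prime] {g : PGL ℚ_[p]} (hg : g ∈ primeClasses p) :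
    g⁻¹ ∈ primeClasses p := by
  obtain ⟨u, hu, hn, rfl⟩ := hg
  refine ⟨star u, ?_, ?_, ?_⟩
  · simpa using star_mem_hurwitz hu
  · simpa using hn
  · rw [← map_inv]
    refine (QuotientGroup.eq (s := scalars ℚ_[p])).2 ?_
    refine ⟨(Units.map (Quaternion.normSq : ℍ[ℚ_[p]] →*₀ ℚ_[p]).toMonoidHom u)⁻¹, ?_⟩
    rw [map_inv, ← mul_inv_rev, inv_inj]
    ext1
    simp [Quaternion.self_mul_star]

theorem norm_normSq_le {p : ℕ} [Fact p.Prime] {x : ℍ[ℚ_[p]]} (hx : x ∈ hurwitz ℤ_[p] ℚ_[p]) :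
    ‖Quaternion.normSq x‖ ≤ 1 := by
  obtain ⟨a, b, c, d, rfl⟩ := hx
  have h : Quaternion.normSq (hquat (algebraMap ℤ_[p] ℚ_[p] a) (algebraMap ℤ_[p] ℚ_[p] b)
      (algebraMap ℤ_[p] ℚ_[p] c) (algebraMap ℤ_[p] ℚ_[p] d)) = algebraMap ℤ_[p] ℚ_[p]
      (a ^ 2 + b ^ 2 + c ^ 2 + d ^ 2 + a * d + b * d + c * d) := by
    rw [Quaternion.normSq_def']
    simp
    ring
  rw [h]
  exact PadicInt.norm_le_one _

theorem primeClasses_disjoint {p : ℕ} [Fact p.Prime] {g : PGL ℚ_[p]} (hg : g ∈ primeClasses p) :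
    g ∉ PGLA ℤ_[p] ℚ_[p] := by
  rintro ⟨_, ⟨w, rfl⟩, hw⟩
  obtain ⟨u, hu, hn, rfl⟩ := hg
  obtain ⟨q, hq⟩ := (QuotientGroup.eq (s := scalars ℚ_[p])).1 hw
  have h1 : ‖Quaternion.normSq (w : ℍ[ℚ_[p]])‖ = 1 := by
    have h2 := norm_normSq_le (w : hurwitz ℤ_[p] ℚ_[p]).2
    have h3 := norm_normSq_le ((w⁻¹ : (hurwitz ℤ_[p] ℚ_[p])ˣ) : hurwitz ℤ_[p] ℚ_[p]).2
    have h4 : ‖Quaternion.normSq (w : ℍ[ℚ_[p]])‖ *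
        ‖Quaternion.normSq (((w⁻¹ : (hurwitz ℤ_[p] ℚ_[p])ˣ) : hurwitz ℤ_[p] ℚ_[p]) : ℍ[ℚ_[p]])‖
          = 1 := by
      rw [← norm_mul, ← map_mul, ← Subring.coe_mul, Units.mul_inv]
      simp
    nlinarith [norm_nonneg (Quaternion.normSq (w : ℍ[ℚ_[p]]))]
  rw [eq_inv_mul_iff_mul_eq] at hq
  have h5 : (w : ℍ[ℚ_[p]]) * algebraMap ℚ_[p] ℍ[ℚ_[p]] q = u := by
    rw [← hq]
    rfl
  have h6 : (p : ℝ)⁻¹ = ‖(q : ℚ_[p])‖ ^ 2 := by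
    rw [← hn, ← h5, map_mul, norm_mul, h1, one_mul, ← norm_pow]
    congr 1
    exact Quaternion.normSq_coe _
  have hpn := Padic.norm_eq_zpow_neg_valuation q.ne_zero
  have hp : (1 : ℝ) < p := by exact_mod_cast (Fact.out : p.Prime).one_lt
  have h7 : (p : ℝ) ^ (-1 : ℤ) = (p : ℝ) ^ (-(q : ℚ_[p]).valuation * 2) := by
    rw [zpow_mul, zpow_neg_one, h6, hpn]
    norm_cast
  have h8 := zpow_right_injective₀ (by linarith) hp.ne' h7
  omega

/-- The Bruhat-Tits tree at `p`: the neighbours of the vertex of `g` are the vertices of `g u`,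
with `u ∈ 𝒜(ℤ_p)` of reduced norm a uniformiser. -/
def tree (p : ℕ) [Fact p.Prime] : SimpleGraph (TreeVertex p) where
  Adj v w := ∃ g h : PGL ℚ_[p], (g : TreeVertex p) = v ∧ (h : TreeVertex p) = w ∧
    g⁻¹ * h ∈ primeClasses p
  symm := by
    constructor
    rintro _ _ ⟨g, h, rfl, rfl, hgh⟩
    exact ⟨h, g, rfl, rfl, by simpa using inv_mem_primeClasses hgh⟩
  loopless := by
    constructor
    rintro _ ⟨g, h, rfl, hg, hgh⟩
    exact primeClasses_disjoint hgh (QuotientGroup.eq.1 hg.symm)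

/-- The group acts on the tree by graph automorphisms. -/
theorem tree_adj_smul (p : ℕ) [Fact p.Prime] (g : PGL ℚ_[p]) {v w : TreeVertex p}
    (h : (tree p).Adj v w) : (tree p).Adj (g • v) (g • w) := by
  obtain ⟨a, b, rfl, rfl, hab⟩ := h
  exact ⟨g * a, g * b, rfl, rfl, by simpa [mul_assoc] using hab⟩

/-- A cell of the product `∏ T_{p+1}`, over `p ∈ S₀`, of trees: a product of a vertex or an edge
from each factor, each given by its set of end points. -/
structure Cell (S : Finset Nat.Primes) where
  face : ∀ p : unram S, Set (TreeVertex p.1)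
  isFace : ∀ p, (∃ v, face p = {v}) ∨ ∃ v w, (tree p.1).Adj v w ∧ face p = {v, w}

/-- `g ∈ Dˣ / ℚˣ` maps the cell `c` onto itself, acting on the factor at `p` through
`Dˣ / ℚˣ → (D ⊗ ℚ_p)ˣ / ℚ_pˣ`. -/
def FixesCell {S : Finset Nat.Primes} (g : PGL ℚ) (c : Cell S) : Prop :=
  ∀ p : unram S, (fun v : TreeVertex p.1 => loc ℚ_[(p.1 : ℕ)] g • v) '' c.face p = c.face p

end HurwitzLattice

end

namespace HurwitzLattice

/-! ### Arithmetic of the Hurwitz order -/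

/-! Since `(i - j)² = -2`, the group `U²` is `1 + 2𝒜(ℤ₂)`, and for odd `p` the set `A_p` consists of
the Hurwitz quaternions of norm `p` congruent to `1` modulo `2` (`mem_A_iff`). The Hurwitz order is
Euclidean, its units represent every class of odd norm modulo `2`, and the only units congruent to
`1` are `±1`. A left ideal generated by an element of odd norm therefore has a generator congruent
to `1`, unique up to sign. So a quaternion of norm `pl` congruent to `1` factors into norms `p` and
`l` in either prescribed order (`exists_factorization`), uniquely up to sign
(`left_divisor_unique`). Applied to `y⁻¹ x`, this yields the squares and hence the permutations.

For the presentation, the square relators collect the letters at one prime `p` at the front of a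
word without changing its length. If two neighbours cancel, the word gets shorter. If none do, the
block is not divisible by `p` (`not_dvd_prod_of_isChain`), whereas a word with trivial image is an
integer scalar whose norm is divisible by `p`; removing the tail, of norm prime to `p`, makes the
block divisible by `p`, a contradiction.

For the action, let `u`, congruent to `1` modulo `2` and of norm `n`, represent an element of `Γ_S`.
If it preserves a cell, its square fixes a vertex of every tree, so the trace `4 re(u)² / n - 2` of
`u² / n` is integral at every prime of `S₀`, hence an integer. Since `re(u)² ≤ n` and `n` is odd, `4
re(u)² / n` is `0` or `4`. The value `4` makes `u` scalar; the value `0` gives `n ≡ 3` modulo `8`,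
which the congruences on `S₀` exclude. A torsion element has the same integral trace, because
otherwise the traces of the powers of `u² / n` would grow `p`-adically. -/

theorem natCast_quaternion_ne_zero {n : ℕ} (hn : n ≠ 0) : (n : ℍ[ℚ]) ≠ 0 := by
  intro h
  have := congrArg QuaternionAlgebra.re h
  rw [Quaternion.re_natCast, Quaternion.re_zero] at this
  exact hn (by exact_mod_cast this)

theorem mul_star_eq_natCast {x : ℍ[ℚ]} {n : ℕ} (h : Quaternion.normSq x = n) :
    x * star x = (n : ℍ[ℚ]) := by
  rw [Quaternion.self_mul_star, h, Quaternion.coe_natCast]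

theorem star_mul_eq_natCast {x : ℍ[ℚ]} {n : ℕ} (h : Quaternion.normSq x = n) :
    star x * x = (n : ℍ[ℚ]) := by
  rw [Quaternion.star_mul_self, h, Quaternion.coe_natCast]

theorem normSq_natCast' (n : ℕ) : Quaternion.normSq (n : ℍ[ℚ]) = (n : ℚ) ^ 2 := by
  rw [← Quaternion.coe_natCast, Quaternion.normSq_coe]

/-- Reduced norms of Hurwitz quaternions are natural numbers. -/
theorem exists_normSq_eq_natCast {x : ℍ[ℚ]} (hx : x ∈ hurwitz ℤ ℚ) :
    ∃ n : ℕ, Quaternion.normSq x = n := by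
  obtain ⟨a, b, c, d, rfl⟩ := hx
  have h : Quaternion.normSq (hquat (algebraMap ℤ ℚ a) (algebraMap ℤ ℚ b)
      (algebraMap ℤ ℚ c) (algebraMap ℤ ℚ d)) =
      ((a ^ 2 + b ^ 2 + c ^ 2 + d ^ 2 + a * d + b * d + c * d : ℤ) : ℚ) := by
    rw [Quaternion.normSq_def']
    simp
    ring
  have h0 : (0 : ℚ) ≤ Quaternion.normSq (hquat (algebraMap ℤ ℚ a) (algebraMap ℤ ℚ b)
      (algebraMap ℤ ℚ c) (algebraMap ℤ ℚ d)) := Quaternion.normSq_nonneg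
  rw [h] at h0
  obtain ⟨n, hn⟩ := Int.eq_ofNat_of_zero_le (by exact_mod_cast h0 :
    0 ≤ a ^ 2 + b ^ 2 + c ^ 2 + d ^ 2 + a * d + b * d + c * d)
  exact ⟨n, by rw [h, hn]; simp⟩

/-- Every rational quaternion has distance less than one from the Hurwitz order. -/
theorem exists_normSq_sub_lt_one (x : ℍ[ℚ]) :
    ∃ a ∈ hurwitz ℤ ℚ, Quaternion.normSq (x - a) < 1 := by
  -- The `k`-coordinate of a Hurwitz quaternion is `d / 2`, so it can be approximated to within `1 /
  -- 4` and the others to within `1 / 2`: the total is at most `3 / 4 + 1 / 16`.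
  set d : ℤ := round (2 * x.imK) with hd
  refine ⟨_, ⟨round (x.re - d / 2), round (x.imI - d / 2), round (x.imJ - d / 2), d, rfl⟩, ?_⟩
  have h0 := abs_le.1 (abs_sub_round (2 * x.imK))
  have h1 := abs_le.1 (abs_sub_round (x.re - d / 2))
  have h2 := abs_le.1 (abs_sub_round (x.imI - d / 2))
  have h3 := abs_le.1 (abs_sub_round (x.imJ - d / 2))
  rw [← hd] at h0
  rw [Quaternion.normSq_def']
  simp only [Quaternion.re_sub, Quaternion.imI_sub, Quaternion.imJ_sub, Quaternion.imK_sub,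
    hquat_re, hquat_imI, hquat_imJ, hquat_imK, eq_intCast]
  have key : ∀ t b : ℚ, -b ≤ t → t ≤ b → t ^ 2 ≤ b ^ 2 := fun t b h h' => sq_le_sq' h h'
  have k1 := key (x.re - (round (x.re - d / 2) + d / 2)) (1 / 2) (by linarith) (by linarith)
  have k2 := key (x.imI - (round (x.imI - d / 2) + d / 2)) (1 / 2) (by linarith) (by linarith)
  have k3 := key (x.imJ - (round (x.imJ - d / 2) + d / 2)) (1 / 2) (by linarith) (by linarith)
  have k4 := key (x.imK - d / 2) (1 / 4) (by linarith) (by linarith)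
  norm_num at k1 k2 k3 k4
  linarith

/-- The left ideal of the Hurwitz order generated by `a` and `b ≠ 0` is principal. -/
theorem exists_left_ideal_generator {a b : ℍ[ℚ]} (ha : a ∈ hurwitz ℤ ℚ) (hb : b ∈ hurwitz ℤ ℚ)
    (hb0 : b ≠ 0) :
    ∃ w ∈ hurwitz ℤ ℚ, (∃ s ∈ hurwitz ℤ ℚ, ∃ t ∈ hurwitz ℤ ℚ, w = s * a + t * b) ∧
      (∃ c ∈ hurwitz ℤ ℚ, a = c * w) ∧ ∃ d ∈ hurwitz ℤ ℚ, b = d * w := by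
  classical
  let L : Set ℍ[ℚ] := {w | ∃ s ∈ hurwitz ℤ ℚ, ∃ t ∈ hurwitz ℤ ℚ, w = s * a + t * b}
  have hLO : ∀ w ∈ L, w ∈ hurwitz ℤ ℚ := by
    rintro _ ⟨s, hs, t, ht, rfl⟩
    exact add_mem (mul_mem hs ha) (mul_mem ht hb)
  have haL : a ∈ L := ⟨1, one_mem _, 0, zero_mem _, by simp⟩
  have hbL : b ∈ L := ⟨0, zero_mem _, 1, one_mem _, by simp⟩
  have hex : ∃ n : ℕ, ∃ w ∈ L, w ≠ 0 ∧ Quaternion.normSq w = n := by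
    obtain ⟨n, hn⟩ := exists_normSq_eq_natCast hb
    exact ⟨n, b, hbL, hb0, hn⟩
  -- A nonzero element of least norm generates: division by it leaves a remainder in the ideal of
  -- smaller norm.
  obtain ⟨w, hwL, hw0, hwn⟩ := Nat.find_spec hex
  have hN : 0 < Quaternion.normSq w :=
    lt_of_le_of_ne Quaternion.normSq_nonneg (Ne.symm (Quaternion.normSq_ne_zero.2 hw0))
  have hdiv : ∀ y ∈ L, ∃ c ∈ hurwitz ℤ ℚ, y = c * w := by
    intro y hy
    obtain ⟨q, hq, hlt⟩ := exists_normSq_sub_lt_one (y * w⁻¹)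
    refine ⟨q, hq, ?_⟩
    have hr : y - q * w = (y * w⁻¹ - q) * w := by
      rw [sub_mul, mul_assoc, inv_mul_cancel₀ hw0, mul_one]
    have hrL : y - q * w ∈ L := by
      obtain ⟨s, hs, t, ht, rfl⟩ := hy
      obtain ⟨s', hs', t', ht', rfl⟩ := hwL
      exact ⟨s - q * s', sub_mem hs (mul_mem hq hs'), t - q * t', sub_mem ht (mul_mem hq ht'),
        by noncomm_ring⟩
    by_contra hne
    obtain ⟨m, hm⟩ := exists_normSq_eq_natCast (hLO _ hrL)
    have hlt' : Quaternion.normSq (y - q * w) < Quaternion.normSq w := by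
      rw [hr, map_mul]
      exact mul_lt_of_lt_one_left hN hlt
    rw [hm, hwn] at hlt'
    exact Nat.find_min hex (by exact_mod_cast hlt') ⟨_, hrL, sub_ne_zero.2 hne, hm⟩
  exact ⟨w, hLO w hwL, hwL, hdiv a haL, hdiv b hbL⟩

/-- The quaternions congruent to `1` modulo `2` in the Hurwitz order. -/
def oneModTwo : Submonoid ℍ[ℚ] where
  carrier := {x | ∃ a ∈ hurwitz ℤ ℚ, x = 1 + 2 * a}
  one_mem' := ⟨0, zero_mem _, by simp⟩
  mul_mem' := by
    rintro _ _ ⟨a, ha, rfl⟩ ⟨b, hb, rfl⟩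
    exact ⟨a + b + 2 * a * b, add_mem (add_mem ha hb) (mul_mem (mul_mem (ofNat_mem _ 2) ha) hb),
      by noncomm_ring⟩

theorem mem_hurwitz_of_mem_oneModTwo {x : ℍ[ℚ]} (hx : x ∈ oneModTwo) : x ∈ hurwitz ℤ ℚ := by
  obtain ⟨a, ha, rfl⟩ := hx
  exact add_mem (one_mem _) (mul_mem (ofNat_mem _ 2) ha)

theorem star_mem_oneModTwo {x : ℍ[ℚ]} (hx : x ∈ oneModTwo) : star x ∈ oneModTwo := by
  obtain ⟨a, ha, rfl⟩ := hx
  exact ⟨star a, star_mem_hurwitz ha, by simp [two_mul]⟩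

/-- Integral coordinates of the quaternions congruent to `1` modulo `2`. -/
theorem exists_coords_of_mem_oneModTwo {x : ℍ[ℚ]} (hx : x ∈ oneModTwo) :
    ∃ a b c d : ℤ, x.re = ((1 + 2 * a + d : ℤ) : ℚ) ∧ x.imI = ((2 * b + d : ℤ) : ℚ) ∧
      x.imJ = ((2 * c + d : ℤ) : ℚ) ∧ x.imK = ((d : ℤ) : ℚ) := by
  obtain ⟨_, ⟨a, b, c, d, rfl⟩, rfl⟩ := hx
  refine ⟨a, b, c, d, ?_, ?_, ?_, ?_⟩ <;> simp [two_mul] <;> ring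

/-- An odd multiple of a Hurwitz quaternion `u` is congruent to `1` modulo `2` only if `u` is. -/
theorem mem_oneModTwo_of_natCast_mul {u : ℍ[ℚ]} {n : ℕ} (hn : Odd n) (hu : u ∈ hurwitz ℤ ℚ)
    (h : (n : ℍ[ℚ]) * u ∈ oneModTwo) : u ∈ oneModTwo := by
  obtain ⟨r, rfl⟩ := hn
  obtain ⟨a, ha, h⟩ := h
  refine ⟨a - r * u, sub_mem ha (mul_mem (natCast_mem _ r) hu), ?_⟩
  rw [mul_sub, ← add_sub_assoc, ← h]
  push_cast
  noncomm_ring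

/-- The only units congruent to `1` modulo `2` are `1` and `-1`. -/
theorem eq_one_or_neg_one_of_normSq_eq_one {u : ℍ[ℚ]} (hu : u ∈ oneModTwo)
    (h : Quaternion.normSq u = 1) : u = 1 ∨ u = -1 := by
  obtain ⟨a, b, c, d, h0, h1, h2, h3⟩ := exists_coords_of_mem_oneModTwo hu
  rw [Quaternion.normSq_def', h0, h1, h2, h3] at h
  have hz : (1 + 2 * a + d) ^ 2 + (2 * b + d) ^ 2 + (2 * c + d) ^ 2 + d ^ 2 = 1 := by
    exact_mod_cast h
  -- If `d ≠ 0`, the term `d ^ 2` exhausts the norm; the vanishing of the first two squares makes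
  -- `d` both odd and even.
  have hd : d = 0 := by
    by_contra hd
    have hd2 : 1 ≤ d ^ 2 := by
      have e1 := sq_nonneg d
      have e2 := pow_ne_zero 2 hd
      omega
    have e0 : (1 + 2 * a + d) ^ 2 = 0 := by nlinarith
    have e1 : (2 * b + d) ^ 2 = 0 := by nlinarith
    have e0' := pow_eq_zero_iff (two_ne_zero) |>.1 e0
    have e1' := pow_eq_zero_iff (two_ne_zero) |>.1 e1
    omega
  subst hd
  have hb : b = 0 := by nlinarith [sq_nonneg (1 + 2 * a), sq_nonneg c, sq_nonneg b]
  have hc : c = 0 := by nlinarith [sq_nonneg (1 + 2 * a), sq_nonneg c, sq_nonneg b]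
  subst hb hc
  have ha : (1 + 2 * a) ^ 2 = 1 := by linarith
  rcases sq_eq_one_iff.1 ha with h | h
  · left; ext <;> simp [h0, h1, h2, h3]; exact_mod_cast (by omega : a = 0)
  · have ha' : (a : ℚ) = -1 := by exact_mod_cast (by omega : a = -1)
    right; ext <;> simp [h0, h1, h2, h3, ha']; norm_num

/-- Every Hurwitz quaternion of odd norm is congruent to a unit modulo `2`. -/
theorem exists_unit_congr {x : ℍ[ℚ]} (hx : x ∈ hurwitz ℤ ℚ) {n : ℕ} (hn : Odd n)
    (h : Quaternion.normSq x = n) :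
    ∃ v ∈ hurwitz ℤ ℚ, Quaternion.normSq v = 1 ∧ ∃ a ∈ hurwitz ℤ ℚ, x = v + 2 * a := by
  obtain ⟨a, b, c, d, rfl⟩ := hx
  have hz : a ^ 2 + b ^ 2 + c ^ 2 + d ^ 2 + a * d + b * d + c * d = n := by
    rw [Quaternion.normSq_def'] at h
    simp at h
    have : ((a ^ 2 + b ^ 2 + c ^ 2 + d ^ 2 + a * d + b * d + c * d : ℤ) : ℚ) = ((n : ℤ) : ℚ) := by
      push_cast
      rw [← h]
      ring
    exact_mod_cast this
  have key : ∀ v0 v1 v2 v3 a' b' c' d' : ℤ,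
      v0 ^ 2 + v1 ^ 2 + v2 ^ 2 + v3 ^ 2 + v0 * v3 + v1 * v3 + v2 * v3 = 1 →
      a = v0 + 2 * a' → b = v1 + 2 * b' → c = v2 + 2 * c' → d = v3 + 2 * d' →
      ∃ v ∈ hurwitz ℤ ℚ, Quaternion.normSq v = 1 ∧ ∃ x ∈ hurwitz ℤ ℚ,
        hquat (algebraMap ℤ ℚ a) (algebraMap ℤ ℚ b) (algebraMap ℤ ℚ c) (algebraMap ℤ ℚ d)
          = v + 2 * x := by
    intro v0 v1 v2 v3 a' b' c' d' hv ha hb hc hd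
    refine ⟨_, ⟨v0, v1, v2, v3, rfl⟩, ?_, _, ⟨a', b', c', d', rfl⟩, ?_⟩
    · rw [Quaternion.normSq_def']
      simp
      have hv' : (v0 ^ 2 + v1 ^ 2 + v2 ^ 2 + v3 ^ 2 + v0 * v3 + v1 * v3 + v2 * v3 : ℚ) = 1 := by
        exact_mod_cast hv
      rw [← hv']
      ring
    · subst ha hb hc hd
      ext <;> simp [two_mul] <;> ring
  have hodd : (a ^ 2 + b ^ 2 + c ^ 2 + d ^ 2 + a * d + b * d + c * d) % 2 = 1 := by
    rw [hz]
    exact_mod_cast Nat.odd_iff.1 hn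
  have ea := Int.emod_add_mul_ediv a 2
  have eb := Int.emod_add_mul_ediv b 2
  have ec := Int.emod_add_mul_ediv c 2
  have ed := Int.emod_add_mul_ediv d 2
  rcases Int.emod_two_eq_zero_or_one a with ha | ha <;>
  rcases Int.emod_two_eq_zero_or_one b with hb | hb <;>
  rcases Int.emod_two_eq_zero_or_one c with hc | hc <;>
  rcases Int.emod_two_eq_zero_or_one d with hd | hd <;>
  first
  | (exfalso; simp [pow_two, Int.add_emod, Int.mul_emod, ha, hb, hc, hd] at hodd; done)
  | (refine key (a % 2) (b % 2) (c % 2) (d % 2) (a / 2) (b / 2) (c / 2) (d / 2) ?_ ea.symm eb.symm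
      ec.symm ed.symm; rw [ha, hb, hc, hd]; norm_num; done)
  | (refine key (-(a % 2)) (-(b % 2)) (-(c % 2)) (d % 2) (a / 2 + a % 2) (b / 2 + b % 2)
      (c / 2 + c % 2) (d / 2) ?_ (by omega) (by omega) (by omega) (by omega)
     rw [ha, hb, hc, hd]; norm_num; done)
  | (refine key (-(a % 2)) (-(b % 2)) (-(c % 2)) 2 (a / 2 + a % 2) (b / 2 + b % 2)
      (c / 2 + c % 2) (d / 2 - 1) ?_ (by omega) (by omega) (by omega) (by omega)
     rw [ha, hb, hc]; norm_num; done)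

theorem exists_unit_mul_mem_oneModTwo {x : ℍ[ℚ]} (hx : x ∈ hurwitz ℤ ℚ) {n : ℕ} (hn : Odd n)
    (h : Quaternion.normSq x = n) :
    ∃ u ∈ hurwitz ℤ ℚ, Quaternion.normSq u = 1 ∧ u * x ∈ oneModTwo := by
  obtain ⟨v, hv, hv1, a, ha, rfl⟩ := exists_unit_congr hx hn h
  have hv1' : star v * v = 1 := by
    rw [Quaternion.star_mul_self, hv1, Quaternion.coe_one]
  refine ⟨star v, star_mem_hurwitz hv, by simpa using hv1, star v * a,
    mul_mem (star_mem_hurwitz hv) ha, ?_⟩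
  rw [mul_add, hv1']
  noncomm_ring

/-- If a Hurwitz quaternion not divisible by `p` is divisible on the right by an element `x` of
norm `p`, then `x` generates the left ideal generated by it and `p`. -/
theorem right_divisor_unique {p : ℕ} (hp : p.Prime) (hp2 : Odd p) {y c c' x x' : ℍ[ℚ]}
    (hy : ¬ ∃ z ∈ hurwitz ℤ ℚ, y = p * z)
    (hc : c ∈ hurwitz ℤ ℚ) (hc' : c' ∈ hurwitz ℤ ℚ) (hx : x ∈ oneModTwo) (hx' : x' ∈ oneModTwo)
    (hn : Quaternion.normSq x = p) (hn' : Quaternion.normSq x' = p)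
    (h : y = c * x) (h' : y = c' * x') : x' = x ∨ x' = -x := by
  have hxO := mem_hurwitz_of_mem_oneModTwo hx
  have hxO' := mem_hurwitz_of_mem_oneModTwo hx'
  have hp0 : (p : ℍ[ℚ]) ≠ 0 := natCast_quaternion_ne_zero hp.ne_zero
  have hpq : (p : ℚ) ≠ 0 := by exact_mod_cast hp.ne_zero
  obtain ⟨w, hw, ⟨s, hs, t, ht, hst⟩, ⟨e, he, hye⟩, ⟨d, hd, hpd⟩⟩ := exists_left_ideal_generator
    (a := y) (b := (p : ℍ[ℚ])) (h ▸ mul_mem hc hxO) (natCast_mem _ p) hp0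
  have gen : ∀ x c : ℍ[ℚ], x ∈ oneModTwo → c ∈ hurwitz ℤ ℚ → Quaternion.normSq x = p → y = c * x →
      ∃ f ∈ hurwitz ℤ ℚ, Quaternion.normSq f = 1 ∧ w = f * x := by
    intro x c hx hc hn h
    refine ⟨s * c + t * star x, add_mem (mul_mem hs hc) (mul_mem ht (star_mem_hurwitz
      (mem_hurwitz_of_mem_oneModTwo hx))), ?_, ?_⟩
    swap
    · rw [hst, h, add_mul, mul_assoc, mul_assoc, star_mul_eq_natCast hn]
    have hwf : w = (s * c + t * star x) * x := by
      rw [hst, h, add_mul, mul_assoc, mul_assoc, star_mul_eq_natCast hn]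
    have hfO : s * c + t * star x ∈ hurwitz ℤ ℚ := add_mem (mul_mem hs hc) (mul_mem ht
      (star_mem_hurwitz (mem_hurwitz_of_mem_oneModTwo hx)))
    set f := s * c + t * star x
    obtain ⟨m, hm⟩ := exists_normSq_eq_natCast hfO
    obtain ⟨k, hk⟩ := exists_normSq_eq_natCast hd
    have hprod : k * m = p := by
      have h1 := congrArg Quaternion.normSq hpd
      rw [normSq_natCast', hwf, map_mul, map_mul, hn, hk, hm] at h1
      have h2 : ((k * m : ℕ) : ℚ) = p := by
        push_cast
        apply mul_right_cancel₀ hpq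
        linarith
      exact_mod_cast h2
    -- If `d` is a unit, then `w` is an associate of `p` and divides `y`, against `hy`; so `f` is
    -- the unit.
    rcases (Nat.dvd_prime hp).1 ⟨m, hprod.symm⟩ with hk1 | hk1
    · exfalso
      apply hy
      refine ⟨e * star d, mul_mem he (star_mem_hurwitz hd), ?_⟩
      have hd1 : star d * d = 1 := by rw [star_mul_eq_natCast hk, hk1, Nat.cast_one]
      rw [hye, Nat.cast_comm, mul_assoc, hpd, ← mul_assoc (star d), hd1, one_mul]
    · have : m = 1 := by
        subst hk1
        exact Nat.eq_of_mul_eq_mul_left hp.pos (by simpa using hprod)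
      rw [hm, this, Nat.cast_one]
  obtain ⟨f, hf, hf1, hwf⟩ := gen x c hx hc hn h
  obtain ⟨f', hf', hf1', hwf'⟩ := gen x' c' hx' hc' hn' h'
  have hu : x' = star f' * f * x := by
    rw [mul_assoc, ← hwf, hwf', ← mul_assoc, Quaternion.star_mul_self, hf1', Quaternion.coe_one,
      one_mul]
  have huO : star f' * f ∈ hurwitz ℤ ℚ := mul_mem (star_mem_hurwitz hf') hf
  -- The unit relating `x` to `x'` becomes `x' * star x` after multiplication by the odd number `p`,
  -- so it is itself `1` modulo `2`.
  have huC : star f' * f ∈ oneModTwo := by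
    refine mem_oneModTwo_of_natCast_mul hp2 huO ?_
    rw [Nat.cast_comm, ← mul_star_eq_natCast hn, ← mul_assoc, ← hu]
    exact mul_mem hx' (star_mem_oneModTwo hx)
  rcases eq_one_or_neg_one_of_normSq_eq_one huC (by simp [hf1, hf1']) with h1 | h1
  · left; rw [hu, h1, one_mul]
  · right; rw [hu, h1, neg_one_mul]

theorem left_divisor_unique {p : ℕ} (hp : p.Prime) (hp2 : Odd p) {y c c' x x' : ℍ[ℚ]}
    (hy : ¬ ∃ z ∈ hurwitz ℤ ℚ, y = p * z)
    (hc : c ∈ hurwitz ℤ ℚ) (hc' : c' ∈ hurwitz ℤ ℚ) (hx : x ∈ oneModTwo) (hx' : x' ∈ oneModTwo)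
    (hn : Quaternion.normSq x = p) (hn' : Quaternion.normSq x' = p)
    (h : y = x * c) (h' : y = x' * c') : x' = x ∨ x' = -x := by
  have := right_divisor_unique (y := star y) (x := star x) (x' := star x') hp hp2 ?_
    (star_mem_hurwitz hc) (star_mem_hurwitz hc') (star_mem_oneModTwo hx) (star_mem_oneModTwo hx')
    (by simpa using hn) (by simpa using hn') (by simp [h]) (by rw [h', star_mul])
  · rwa [← star_neg, star_inj, star_inj] at this
  · rintro ⟨z, hz, hyz⟩
    refine hy ⟨star z, star_mem_hurwitz hz, ?_⟩
    rw [← star_star y, hyz, star_mul, star_natCast, Nat.cast_comm]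

theorem dvd_of_normSq {p : ℕ} {x z : ℍ[ℚ]} (hz : z ∈ hurwitz ℤ ℚ)
    {n : ℕ} (hn : Quaternion.normSq x = n) (h : x = p * z) : p ^ 2 ∣ n := by
  obtain ⟨m, hm⟩ := exists_normSq_eq_natCast hz
  refine ⟨m, ?_⟩
  rw [h, map_mul, hm, normSq_natCast'] at hn
  exact_mod_cast hn.symm

/-- Factorisation of quaternions according to a factorisation of the norm. -/
theorem exists_factorization {p m : ℕ} (hp : p.Prime) (hp2 : Odd p) (hm : ¬ p ∣ m) {z : ℍ[ℚ]}
    (hz : z ∈ oneModTwo) (hn : Quaternion.normSq z = (m * p : ℕ)) :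
    ∃ w ∈ oneModTwo, ∃ x ∈ oneModTwo, z = w * x ∧ Quaternion.normSq w = m ∧
      Quaternion.normSq x = p := by
  have hzO := mem_hurwitz_of_mem_oneModTwo hz
  have hp0 : (p : ℍ[ℚ]) ≠ 0 := natCast_quaternion_ne_zero hp.ne_zero
  have hpq : (p : ℚ) ≠ 0 := by exact_mod_cast hp.ne_zero
  obtain ⟨w, hw, ⟨s, hs, t, ht, hst⟩, ⟨e, he, hze⟩, ⟨d, hd, hpd⟩⟩ := exists_left_ideal_generator
    (a := z) (b := (p : ℍ[ℚ])) hzO (natCast_mem _ p) hp0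
  obtain ⟨k, hk⟩ := exists_normSq_eq_natCast hw
  obtain ⟨l, hl⟩ := exists_normSq_eq_natCast he
  obtain ⟨r, hr⟩ := exists_normSq_eq_natCast hd
  have h1 : p ^ 2 = r * k := by
    have := congrArg Quaternion.normSq hpd
    rw [normSq_natCast', map_mul, hr, hk] at this
    exact_mod_cast this
  have h2 : m * p = l * k := by
    have := congrArg Quaternion.normSq hze
    rw [hn, map_mul, hl, hk] at this
    exact_mod_cast this
  -- The norm of `w` divides `p ^ 2`. It is not `1`, since `w * star w` expands to a multiple of `p`
  -- because `z * star z` is one; it is not `p ^ 2`, since then `p` would divide `m`.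
  have hkp : k = p := by
    obtain ⟨i, hi, rfl⟩ := (Nat.dvd_prime_pow hp).1 (Dvd.intro_left r h1.symm : k ∣ p ^ 2)
    interval_cases i
    · exfalso
      have hk' : ((p ^ 0 : ℕ) : ℍ[ℚ]) = p * (m * (s * star s) + s * z * star t + t * star z * star s
          + p * (t * star t)) := by
        have hz' : z * star z = m * p := by rw [mul_star_eq_natCast hn, Nat.cast_mul]
        have e1 : s * z * (star z * star s) = (p : ℍ[ℚ]) * (m * (s * star s)) := by
          rw [mul_assoc, ← mul_assoc z, hz', mul_assoc, ← mul_assoc s, ← Nat.cast_comm m s,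
            mul_assoc, ← mul_assoc s, ← Nat.cast_comm p s, mul_assoc, ← mul_assoc, ← mul_assoc,
            Nat.cast_comm m (p : ℍ[ℚ]), mul_assoc, mul_assoc]
        have e2 : s * z * (p * star t) = (p : ℍ[ℚ]) * (s * z * star t) := by
          rw [← mul_assoc, ← Nat.cast_comm, mul_assoc]
        have e3 : t * p * (star z * star s) = (p : ℍ[ℚ]) * (t * star z * star s) := by
          rw [← Nat.cast_comm, mul_assoc, mul_assoc]
        have e4 : t * p * (p * star t) = (p : ℍ[ℚ]) * (p * (t * star t)) := by
          rw [← Nat.cast_comm, mul_assoc, ← mul_assoc t, ← Nat.cast_comm, mul_assoc]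
        rw [← mul_star_eq_natCast hk, hst, star_add, star_mul, star_mul, star_natCast, add_mul,
          mul_add, mul_add, e1, e2, e3, e4]
        noncomm_ring
      have hdvd := dvd_of_normSq (p := p) (n := 1) (add_mem (add_mem (add_mem (mul_mem
        (natCast_mem _ m) (mul_mem hs (star_mem_hurwitz hs))) (mul_mem (mul_mem hs hzO)
        (star_mem_hurwitz ht))) (mul_mem (mul_mem ht (star_mem_hurwitz hzO)) (star_mem_hurwitz hs)))
        (mul_mem (natCast_mem _ p) (mul_mem ht (star_mem_hurwitz ht)))) (by simp) hk'
      have := hp.two_le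
      have := Nat.le_of_dvd one_pos hdvd
      nlinarith
    · simp
    · exfalso
      rw [pow_two, ← mul_assoc] at h2
      exact hm ⟨l, by rw [Nat.eq_of_mul_eq_mul_right hp.pos h2, mul_comm]⟩
  subst hkp
  have hlm : l = m := (Nat.eq_of_mul_eq_mul_right hp.pos h2).symm
  -- The generator is only determined up to a left unit, chosen here to make it `1` modulo `2`; the
  -- cofactor then inherits the congruence.
  obtain ⟨u, hu, hu1, huw⟩ := exists_unit_mul_mem_oneModTwo hw hp2 hk
  have hz' : z = e * star u * (u * w) := by
    rw [mul_assoc, ← mul_assoc (star u), Quaternion.star_mul_self, hu1, Quaternion.coe_one, one_mul,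
      hze]
  have hnx : Quaternion.normSq (u * w) = k := by rw [map_mul, hu1, one_mul, hk]
  refine ⟨e * star u, ?_, u * w, huw, hz', ?_, hnx⟩
  · refine mem_oneModTwo_of_natCast_mul hp2 (mul_mem he (star_mem_hurwitz hu)) ?_
    rw [Nat.cast_comm, ← mul_star_eq_natCast hnx, ← mul_assoc, ← hz']
    exact mul_mem hz (star_mem_oneModTwo huw)
  · rw [map_mul, Quaternion.normSq_star, hu1, mul_one, hl, hlm]

/-! ### The sets `A_p` and `PA_p` -/

theorem extend_mem_hurwitz {R K : Type*} [CommRing R] [Field K] [CharZero K] [Algebra R K]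
    [Algebra ℚ K] {x : ℍ[ℚ]} (hx : x ∈ hurwitz ℤ ℚ) : extend K x ∈ hurwitz R K := by
  obtain ⟨a, b, c, d, rfl⟩ := hx
  refine ⟨a, b, c, d, ?_⟩
  ext <;> simp [extend]

/-- This identifies `𝔪₂²` with the ideal generated by `2`. -/
theorem sq_quat_i_sub_j (K : Type*) [Field K] : quat (0 : K) 1 (-1) 0 ^ 2 = -2 := by
  have h : (-2 : ℍ[K]) = quat (-2) 0 0 0 := by
    rw [← one_add_one_eq_two]
    ext <;> simp
    norm_num
  rw [h]
  ext <;> simp [pow_two]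
  norm_num

theorem mem_kerPsi_of_mem_oneModTwo {x : ℍ[ℚ]} (hx : x ∈ oneModTwo) : x ∈ kerPsi := by
  obtain ⟨a, ha, rfl⟩ := hx
  refine ⟨1, one_ne_zero, _, ⟨-extend ℚ_[2] a, neg_mem (extend_mem_hurwitz ha), rfl⟩, ?_⟩
  rw [sq_quat_i_sub_j, map_add, map_mul, map_one, map_ofNat, one_smul, neg_mul_neg]

theorem norm_two_mul_padicInt_lt_one (x : ℤ_[2]) : ‖(2 : ℚ_[2]) * x‖ < 1 := by
  rw [norm_mul]
  have h : ‖(2 : ℚ_[2])‖ = 2⁻¹ := by exact_mod_cast Padic.norm_p (p := 2)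
  have := PadicInt.norm_le_one x
  rw [h]
  have h2 : ‖(x : ℚ_[2])‖ ≤ 1 := this
  linarith

theorem norm_one_add_eq_one {p : ℕ} [Fact p.Prime] {x : ℚ_[p]} (hx : ‖x‖ < 1) : ‖1 + x‖ = 1 := by
  have h1 : ‖(1 : ℚ_[p])‖ = 1 := norm_one
  rw [Padic.add_eq_max_of_ne (by rw [h1]; exact hx.ne'), h1, max_eq_left hx.le]

theorem even_of_norm_lt_one {n : ℤ} (h : ‖(n : ℚ_[2])‖ < 1) : (2 : ℤ) ∣ n := by
  exact_mod_cast (Padic.norm_intCast_lt_one_iff (p := 2)).1 h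

/-- If `x = q • u` with `u ∈ 1 + 2𝒜(ℤ₂)`, then `u` has unit norm and `x` has odd norm, so `q` is a
2-adic unit. Hence the coordinates `b`, `c`, `d` are even, and `a` is odd because the norm is. -/
theorem mem_A_iff {p : ℕ} (hp : Odd p) {x : ℍ[ℚ]} :
    x ∈ A p ↔ x ∈ oneModTwo ∧ Quaternion.normSq x = (p : ℚ) := by
  refine ⟨?_, fun h => ⟨mem_hurwitz_of_mem_oneModTwo h.1, h.2, mem_kerPsi_of_mem_oneModTwo h.1⟩⟩
  rintro ⟨⟨a, b, c, d, rfl⟩, hn, q, -, _, ⟨_, ⟨r, s, t, v, rfl⟩, rfl⟩, hx⟩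
  refine ⟨?_, hn⟩
  rw [sq_quat_i_sub_j] at hx
  have e0 := congrArg QuaternionAlgebra.re hx
  have e1 := congrArg QuaternionAlgebra.imI hx
  have e2 := congrArg QuaternionAlgebra.imJ hx
  have e3 := congrArg QuaternionAlgebra.imK hx
  simp [extend, two_mul] at e0 e1 e2 e3
  have hd : (d : ℚ_[2]) = -(q * (2 * v)) := by linear_combination 2 * e3
  have hc : (c : ℚ_[2]) = -(q * (2 * t)) := by linear_combination e2 - e3
  have hb : (b : ℚ_[2]) = -(q * (2 * s)) := by linear_combination e1 - e3
  have ha : (a : ℚ_[2]) = q * (1 + 2 * (-r : ℤ_[2])) := by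
    push_cast
    linear_combination e0 - e3
  have hnz : a ^ 2 + b ^ 2 + c ^ 2 + d ^ 2 + a * d + b * d + c * d = p := by
    rw [Quaternion.normSq_def'] at hn
    simp at hn
    have : ((a ^ 2 + b ^ 2 + c ^ 2 + d ^ 2 + a * d + b * d + c * d : ℤ) : ℚ) = ((p : ℤ) : ℚ) := by
      push_cast
      rw [← hn]
      ring
    exact_mod_cast this
  have hp1 : ‖(p : ℚ_[2])‖ = 1 := by
    refine le_antisymm (by exact_mod_cast Padic.norm_int_le_one (p := 2) p) (not_lt.1 fun h => ?_)
    have := even_of_norm_lt_one (n := p) (by exact_mod_cast h)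
    obtain ⟨k, rfl⟩ := hp
    omega
  have hq : ‖q‖ = 1 := by
    have : (p : ℚ_[2]) = q ^ 2 * (1 + 2 * ((-2 * r + 2 * r ^ 2 + 2 * s ^ 2 + 2 * t ^ 2 + 2 * v ^ 2
        - v + 2 * r * v + 2 * s * v + 2 * t * v : ℤ_[2]) : ℚ_[2])) := by
      have h : (((a ^ 2 + b ^ 2 + c ^ 2 + d ^ 2 + a * d + b * d + c * d : ℤ)) : ℚ_[2]) =
        ((p : ℤ) : ℚ_[2]) := by rw [hnz]
      push_cast at h ⊢
      rw [← h, ha, hb, hc, hd]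
      have h2 : ((2 : ℤ_[2]) : ℚ_[2]) = 2 := rfl
      push_cast
      rw [h2]
      ring
    rw [this, norm_mul, norm_one_add_eq_one (norm_two_mul_padicInt_lt_one _), mul_one,
      norm_pow] at hp1
    exact (pow_eq_one_iff_of_nonneg (norm_nonneg q) two_ne_zero).1 hp1
  have hsmall : ∀ (n : ℤ) (y : ℤ_[2]), (n : ℚ_[2]) = -(q * (2 * y)) → (2 : ℤ) ∣ n := by
    intro n y h
    apply even_of_norm_lt_one
    rw [h, norm_neg, norm_mul, hq, one_mul]
    exact norm_two_mul_padicInt_lt_one y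
  obtain ⟨b, rfl⟩ := hsmall b s hb
  obtain ⟨c, rfl⟩ := hsmall c t hc
  obtain ⟨d, rfl⟩ := hsmall d v hd
  have hodd : a % 2 = 1 := by
    by_contra h0
    obtain ⟨a, rfl⟩ : (2 : ℤ) ∣ a := by omega
    have : (p : ℤ) = 2 * (2 * (a ^ 2 + b ^ 2 + c ^ 2 + d ^ 2 + a * d + b * d + c * d)) := by
      rw [← hnz]
      ring
    obtain ⟨k, rfl⟩ := hp
    omega
  obtain ⟨a, rfl⟩ : ∃ k, a = 1 + 2 * k := ⟨a / 2, by omega⟩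
  refine ⟨_, ⟨a, b, c, d, rfl⟩, ?_⟩
  ext <;> simp [two_mul] <;> ring

theorem cls_eq_iff {K : Type*} [Field K] {u v : ℍ[K]ˣ} :
    cls u = cls v ↔ ∃ q : Kˣ, (v : ℍ[K]) = u * algebraMap K ℍ[K] q := by
  refine (QuotientGroup.eq (s := scalars K)).trans ⟨?_, ?_⟩
  · rintro ⟨q, hq⟩
    rw [eq_inv_mul_iff_mul_eq] at hq
    exact ⟨q, by rw [← hq]; rfl⟩
  · rintro ⟨q, hq⟩
    refine ⟨q, ?_⟩
    rw [eq_inv_mul_iff_mul_eq]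
    ext1
    exact hq.symm

theorem cls_surjective {K : Type*} [Field K] (g : PGL K) : ∃ u : ℍ[K]ˣ, cls u = g :=
  QuotientGroup.mk'_surjective (scalars K) g

theorem cls_eq_of_eq_or_eq_neg {u v : ℍ[ℚ]ˣ} (h : (v : ℍ[ℚ]) = u ∨ (v : ℍ[ℚ]) = -u) :
    cls u = cls v := by
  rcases h with h | h
  · exact cls_eq_iff.2 ⟨1, by simp [h]⟩
  · exact cls_eq_iff.2 ⟨-1, by simp [h]⟩

/-- Equality of norms forces the scalar factor to have square `1`. -/
theorem eq_or_eq_neg_of_cls_eq {u v : ℍ[ℚ]ˣ} (h : cls u = cls v)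
    (hn : Quaternion.normSq (u : ℍ[ℚ]) = Quaternion.normSq (v : ℍ[ℚ])) :
    (v : ℍ[ℚ]) = u ∨ (v : ℍ[ℚ]) = -u := by
  obtain ⟨q, hq⟩ := cls_eq_iff.1 h
  have h0 : Quaternion.normSq (u : ℍ[ℚ]) ≠ 0 := Quaternion.normSq_ne_zero.2 u.ne_zero
  have h1 : Quaternion.normSq (algebraMap ℚ ℍ[ℚ] q) = (q : ℚ) ^ 2 := Quaternion.normSq_coe _
  rw [hq, map_mul, h1] at hn
  have h2 : (q : ℚ) ^ 2 = 1 := mul_left_cancel₀ h0 (by rw [← hn, mul_one])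
  rcases sq_eq_one_iff.1 h2 with h | h
  · left; rw [hq, h]; simp
  · right; rw [hq, h]; simp

theorem cls_star {K : Type*} [Field K] {u v : ℍ[K]ˣ} (h : (v : ℍ[K]) = star (u : ℍ[K])) :
    cls v = (cls u)⁻¹ := by
  rw [eq_inv_iff_mul_eq_one, ← map_mul, eq_comm, ← map_one (cls (K := K)), cls_eq_iff]
  refine ⟨Units.map (Quaternion.normSq : ℍ[K] →*₀ K).toMonoidHom u, ?_⟩
  rw [Units.val_mul, h, Quaternion.star_mul_self]
  simp

theorem exists_rep_of_mem_PA {p : ℕ} (hp : Odd p) {x : PGL ℚ} (hx : x ∈ PA p) :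
    ∃ u : ℍ[ℚ]ˣ, cls u = x ∧ (u : ℍ[ℚ]) ∈ oneModTwo ∧ Quaternion.normSq (u : ℍ[ℚ]) = p := by
  obtain ⟨u, hu, rfl⟩ := hx
  exact ⟨u, rfl, (mem_A_iff hp).1 hu⟩

theorem cls_mem_PA {p : ℕ} (hp : Odd p) {u : ℍ[ℚ]ˣ} (hu : (u : ℍ[ℚ]) ∈ oneModTwo)
    (hn : Quaternion.normSq (u : ℍ[ℚ]) = p) : cls u ∈ PA p :=
  ⟨u, (mem_A_iff hp).2 ⟨hu, hn⟩, rfl⟩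

theorem inv_mem_PA {p : ℕ} (hp : Odd p) {x : PGL ℚ} (hx : x ∈ PA p) : x⁻¹ ∈ PA p := by
  obtain ⟨u, rfl, hu, hn⟩ := exists_rep_of_mem_PA hp hx
  rw [← cls_star (v := star u) rfl]
  exact cls_mem_PA hp (star_mem_oneModTwo hu) (by simpa using hn)

/-- The product of representatives has norm `p * l`, not divisible by `p ^ 2`, so it is not
divisible by `p` and its left divisor of norm `p` is determined up to sign. -/
theorem PA_mul_injective {p l : ℕ} (hp : p.Prime) (hl : l.Prime) (hp2 : Odd p) (hl2 : Odd l)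
    (hpl : p ≠ l) {a a' b b' : PGL ℚ} (ha : a ∈ PA p) (ha' : a' ∈ PA p) (hb : b ∈ PA l)
    (hb' : b' ∈ PA l) (h : a * b = a' * b') : a = a' ∧ b = b' := by
  suffices a = a' by
    subst this
    exact ⟨rfl, mul_left_cancel h⟩
  obtain ⟨u, rfl, hu, hun⟩ := exists_rep_of_mem_PA hp2 ha
  obtain ⟨u', rfl, hu', hun'⟩ := exists_rep_of_mem_PA hp2 ha'
  obtain ⟨v, rfl, hv, hvn⟩ := exists_rep_of_mem_PA hl2 hb
  obtain ⟨v', rfl, hv', hvn'⟩ := exists_rep_of_mem_PA hl2 hb'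
  rw [← map_mul, ← map_mul] at h
  have huv := eq_or_eq_neg_of_cls_eq h (by simp [hun, hun', hvn, hvn'])
  obtain ⟨w, hw, hw'⟩ : ∃ w ∈ hurwitz ℤ ℚ, (u : ℍ[ℚ]) * v = u' * w := by
    have := mem_hurwitz_of_mem_oneModTwo hv'
    rcases huv with h | h
    · exact ⟨v', this, h.symm⟩
    · exact ⟨-v', neg_mem this, by rw [mul_neg, ← Units.val_mul, ← Units.val_mul, h, neg_neg]⟩
  refine cls_eq_of_eq_or_eq_neg (left_divisor_unique (y := (u : ℍ[ℚ]) * v) hp hp2 ?_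
    (mem_hurwitz_of_mem_oneModTwo hv) hw hu hu' hun hun' rfl hw')
  rintro ⟨z, hz, hyz⟩
  have hdvd := dvd_of_normSq (n := p * l) hz (by simp [hun, hvn]) hyz
  rw [pow_two, Nat.mul_dvd_mul_iff_left hp.pos, Nat.prime_dvd_prime_iff_eq hp hl] at hdvd
  exact hpl hdvd

theorem exists_PA_mul_eq {p l : ℕ} (hp : p.Prime) (hl : l.Prime) (hp2 : Odd p) (hl2 : Odd l)
    (hpl : p ≠ l) {a b : PGL ℚ} (ha : a ∈ PA p) (hb : b ∈ PA l) :
    ∃ b' ∈ PA l, ∃ a' ∈ PA p, a * b = b' * a' := by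
  obtain ⟨u, rfl, hu, hun⟩ := exists_rep_of_mem_PA hp2 ha
  obtain ⟨v, rfl, hv, hvn⟩ := exists_rep_of_mem_PA hl2 hb
  obtain ⟨w, hw, x, hx, h, hwn, hxn⟩ := exists_factorization (z := (u : ℍ[ℚ]) * v) hp hp2
    (fun hd => hpl ((Nat.prime_dvd_prime_iff_eq hp hl).1 hd)) (mul_mem hu hv)
    (by simp [hun, hvn, mul_comm])
  have hw0 : w ≠ 0 := Quaternion.normSq_ne_zero.1 (by rw [hwn]; exact_mod_cast hl.ne_zero)
  have hx0 : x ≠ 0 := Quaternion.normSq_ne_zero.1 (by rw [hxn]; exact_mod_cast hp.ne_zero)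
  refine ⟨cls (Units.mk0 w hw0), cls_mem_PA hl2 hw hwn, cls (Units.mk0 x hx0),
    cls_mem_PA hp2 hx hxn, ?_⟩
  rw [← map_mul, ← map_mul]
  congr 1
  ext1
  exact h

/-- A square is the same thing as a rewriting of `y⁻¹ * x` as `x' * y'⁻¹`, that is, with the two
primes exchanged. -/
theorem exists_square {p l : ℕ} (hp : p.Prime) (hl : l.Prime) (hp2 : Odd p) (hl2 : Odd l)
    (hpl : p ≠ l) {x y : PGL ℚ} (hx : x ∈ PA p) (hy : y ∈ PA l) :
    ∃ y' ∈ PA l, ∃ x' ∈ PA p, x * y' = y * x' := by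
  obtain ⟨x', hx', y', hy', h⟩ := exists_PA_mul_eq hl hp hl2 hp2 hpl.symm (inv_mem_PA hl2 hy) hx
  refine ⟨y'⁻¹, inv_mem_PA hl2 hy', x', hx', ?_⟩
  rw [mul_inv_eq_iff_eq_mul, mul_assoc, ← h, mul_inv_cancel_left]

theorem square_unique {p l : ℕ} (hp : p.Prime) (hl : l.Prime) (hp2 : Odd p) (hl2 : Odd l)
    (hpl : p ≠ l) {x x' x'' y y' y'' : PGL ℚ} (hx' : x' ∈ PA p) (hx'' : x'' ∈ PA p)
    (hy' : y' ∈ PA l) (hy'' : y'' ∈ PA l) (h : x * y' = y * x') (h' : x * y'' = y * x'') :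
    y' = y'' ∧ x' = x'' := by
  have e : ∀ x' y', x * y' = y * x' → y⁻¹ * x = x' * y'⁻¹ := by
    intro x' y' h
    rw [eq_mul_inv_iff_mul_eq, mul_assoc, h, inv_mul_cancel_left]
  obtain ⟨h1, h2⟩ := PA_mul_injective hp hl hp2 hl2 hpl hx' hx'' (inv_mem_PA hl2 hy')
    (inv_mem_PA hl2 hy'') ((e _ _ h).symm.trans (e _ _ h'))
  exact ⟨inv_injective h2, h1⟩

/-! ### The square permutations -/

theorem odd_of_mem_unram {S : Finset Nat.Primes} (p : unram S) : Odd (p.1 : ℕ) := by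
  refine p.1.2.odd_of_ne_two fun h => ?_
  exact (Finset.mem_erase.1 p.2).1 (Subtype.ext h)

theorem coe_ne_of_ne {S : Finset Nat.Primes} {p l : unram S} (h : p ≠ l) :
    (p.1 : ℕ) ≠ (l.1 : ℕ) := fun e => h (Subtype.ext (Subtype.ext e))

theorem exists_square_unram {S : Finset Nat.Primes} {p l : unram S} (h : p ≠ l) (x : PA p.1)
    (y : PA l.1) : ∃ q : PA l.1 × PA p.1, (x : PGL ℚ) * q.1 = y * q.2 := by
  obtain ⟨y', hy', x', hx', e⟩ := exists_square p.1.2 l.1.2 (odd_of_mem_unram p)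
    (odd_of_mem_unram l) (coe_ne_of_ne h) x.2 y.2
  exact ⟨(⟨y', hy'⟩, ⟨x', hx'⟩), e⟩

theorem square_unique_unram {S : Finset Nat.Primes} {p l : unram S} (h : p ≠ l) {x x' x'' : PA p.1}
    {y y' y'' : PA l.1} (e : (x : PGL ℚ) * y' = y * x') (e' : (x : PGL ℚ) * y'' = y * x'') :
    y' = y'' ∧ x' = x'' := by
  obtain ⟨h1, h2⟩ := square_unique p.1.2 l.1.2 (odd_of_mem_unram p) (odd_of_mem_unram l)
    (coe_ne_of_ne h) x'.2 x''.2 y'.2 y''.2 e e'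
  exact ⟨Subtype.ext h1, Subtype.ext h2⟩

/-- Both halves read the square from its corner `x * y'`: it has at most one factorisation `y * x'`
(injectivity) and at least one (surjectivity). -/
theorem bijective_of_square {S : Finset Nat.Primes} {p l : unram S} (h : p ≠ l) (x : PA p.1)
    (f : PA l.1 → PA l.1 × PA p.1) (hf : ∀ y, (x : PGL ℚ) * (f y).1 = y * (f y).2) :
    Function.Bijective fun y => (f y).1 := by
  constructor
  · intro y z hyz
    have hyz' : (f y).1 = (f z).1 := hyz
    refine Subtype.ext (PA_mul_injective l.1.2 p.1.2 (odd_of_mem_unram l) (odd_of_mem_unram p)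
      (coe_ne_of_ne h.symm) y.2 z.2 (f y).2.2 (f z).2.2 ?_).1
    rw [← hf, ← hf, hyz']
  · intro y'
    obtain ⟨y, hy, x', hx', e⟩ := exists_PA_mul_eq p.1.2 l.1.2 (odd_of_mem_unram p)
      (odd_of_mem_unram l) (coe_ne_of_ne h) x.2 y'.2
    refine ⟨⟨y, hy⟩, ?_⟩
    exact (square_unique_unram (x' := (f ⟨y, hy⟩).2) (x'' := ⟨x', hx'⟩) h (hf ⟨y, hy⟩) e).1

theorem existsUnique_squareFamily (S : Finset Nat.Primes) :
    ∃! σ : PermFamily S, IsSquareFamily σ := by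
  classical
  choose f hf using fun (p l : unram S) (h : p ≠ l) (x : PA p.1) (y : PA l.1) =>
    exists_square_unram h x y
  refine ⟨fun p l h x => Equiv.ofBijective _ (bijective_of_square h x (f p l h x) (hf p l h x)),
    ?_, ?_⟩
  · intro p l h x y
    have h1 := hf p l h x y
    -- The squares for `(p, l)` and `(l, p)` were chosen independently; uniqueness makes them agree.
    have h2 := hf l p h.symm y x
    have h3 := (square_unique_unram h h1 h2.symm).2
    simp only [Equiv.ofBijective_apply]
    rw [← h3, h1]
  · intro τ hτ
    funext p l h x
    ext1 y
    exact (square_unique_unram h (hτ p l h x y) (hf p l h x y)).1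

/-! ### Reduced words -/

/-- By Bézout, `x` is an integral combination of `x * p` and `x * m = x * w * star w`, both
divisible by `p`. -/
theorem dvd_of_dvd_mul {p m : ℕ} (hpm : Nat.Coprime p m) {x w z : ℍ[ℚ]} (hx : x ∈ hurwitz ℤ ℚ)
    (hw : w ∈ hurwitz ℤ ℚ) (hn : Quaternion.normSq w = m) (hz : z ∈ hurwitz ℤ ℚ)
    (h : x * w = p * z) : ∃ y ∈ hurwitz ℤ ℚ, x = p * y := by
  obtain ⟨r, s, hrs⟩ : ∃ r s : ℤ, 1 = p * r + m * s :=
    ⟨_, _, by simpa [hpm.gcd_eq_one] using Nat.gcd_eq_gcd_ab p m⟩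
  have hxm : x * m = p * (z * star w) := by
    rw [← mul_star_eq_natCast hn, ← mul_assoc, h, mul_assoc]
  refine ⟨x * r + z * star w * s, add_mem (mul_mem hx (intCast_mem _ r)) (mul_mem (mul_mem hz
    (star_mem_hurwitz hw)) (intCast_mem _ s)), ?_⟩
  have h1 : (1 : ℍ[ℚ]) = p * r + m * s := by exact_mod_cast congrArg (Int.cast (R := ℍ[ℚ])) hrs
  calc x = x * (p * r + m * s) := by rw [← h1, mul_one]
    _ = _ := by rw [mul_add, ← mul_assoc, ← mul_assoc, hxm, ← Nat.cast_comm]; noncomm_ring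

/-- A word in quaternions of norm `p` without cancellation is not divisible by `p`. -/
theorem not_dvd_prod_of_isChain {p : ℕ} (hp : p.Prime) (hp2 : Odd p) (l : List ℍ[ℚ])
    (hl : ∀ x ∈ l, x ∈ oneModTwo ∧ Quaternion.normSq x = p)
    (hc : l.IsChain fun x y => y ≠ star x ∧ y ≠ -star x) :
    ¬ ∃ z ∈ hurwitz ℤ ℚ, l.prod = p * z := by
  induction l with
  | nil =>
    rintro ⟨z, hz, h⟩
    have := dvd_of_normSq (n := 1) hz (by simp) h
    have := Nat.le_of_dvd one_pos this
    nlinarith [hp.two_le]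
  | cons x l ih =>
    obtain ⟨hx, hxn⟩ := hl x List.mem_cons_self
    have hl' : ∀ y ∈ l, y ∈ oneModTwo ∧ Quaternion.normSq y = p :=
      fun y hy => hl y (List.mem_cons_of_mem _ hy)
    cases l with
    | nil =>
      rintro ⟨z, hz, h⟩
      have := dvd_of_normSq (n := p) hz (by simpa using hxn) h
      have := Nat.le_of_dvd hp.pos this
      nlinarith [hp.two_le]
    | cons y l =>
      rw [List.isChain_cons_cons] at hc
      rintro ⟨z, hz, h⟩
      have ih' := ih hl' hc.2
      obtain ⟨hy, hyn⟩ := hl' y List.mem_cons_self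
      rw [List.prod_cons] at h
      -- Writing `p = x * star x` and cancelling `x` exhibits `star x` as a left divisor of the
      -- remaining word. So is `y`, and uniqueness gives the forbidden `y = ±star x`.
      have h1 : (y :: l).prod = star x * z := by
        apply mul_left_cancel₀ (natCast_quaternion_ne_zero hp.ne_zero)
        rw [← mul_assoc _ (star x), Nat.cast_comm p (star x), mul_assoc, ← h, ← mul_assoc,
          star_mul_eq_natCast hxn]
      have hlO : l.prod ∈ hurwitz ℤ ℚ := list_prod_mem fun w hw =>
        mem_hurwitz_of_mem_oneModTwo (hl' w (List.mem_cons_of_mem _ hw)).1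
      rcases left_divisor_unique hp hp2 ih' hz hlO (star_mem_oneModTwo hx) hy (by simpa using hxn)
        hyn h1 List.prod_cons with h2 | h2
      · exact hc.1.1 h2
      · exact hc.1.2 h2

/-- The scalar is an integer, being a real part in `oneModTwo`, and its square is divisible by `p`.
-/
theorem dvd_of_eq_algebraMap {p n : ℕ} (hp : p.Prime) {x : ℍ[ℚ]} (hx : x ∈ oneModTwo) {q : ℚ}
    (hq : x = algebraMap ℚ ℍ[ℚ] q) (hn : Quaternion.normSq x = n) (hpn : p ∣ n) :
    ∃ z ∈ hurwitz ℤ ℚ, x = p * z := by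
  obtain ⟨a, b, c, d, h0, -, -, -⟩ := exists_coords_of_mem_oneModTwo hx
  set k := 1 + 2 * a + d
  have hre : x.re = q := by rw [hq]; rfl
  have hqk : q = k := by rw [← hre, h0]
  have hxk : x = (k : ℍ[ℚ]) := by rw [hq, hqk]; simp
  have hk : k ^ 2 = n := by
    have h1 : Quaternion.normSq (algebraMap ℚ ℍ[ℚ] q) = (q : ℚ) ^ 2 := Quaternion.normSq_coe _
    rw [hq, h1, hqk] at hn
    exact_mod_cast hn
  obtain ⟨r, hr⟩ : (p : ℤ) ∣ k :=
    Int.Prime.dvd_pow' hp (by rw [hk]; exact_mod_cast hpn : (p : ℤ) ∣ k ^ 2)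
  exact ⟨r, intCast_mem _ r, by rw [hxk, hr]; push_cast; rfl⟩

/-! ### The presentation -/

section presentation

variable {S : Finset Nat.Primes}

/-- Letters of words in the generators, remembering the prime. -/
abbrev Letter (S : Finset Nat.Primes) : Type := Σ p : unram S, PA p.1

/-- The defining relators of `Γ_S`. -/
abbrev relators (σ : PermFamily S) : Set (FreeGroup (gens S)) :=
  inverseRelators S ∪ squareRelators σ

/-- The element of the presented group given by a letter. -/
def letter (σ : PermFamily S) (a : Letter S) : PresentedGroup (relators σ) :=
  PresentedGroup.mk _ (gen a.2)

/-- The element of the presented group given by a word. -/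
def word (σ : PermFamily S) (l : List (Letter S)) : PresentedGroup (relators σ) :=
  (l.map (letter σ)).prod

/-- The inclusion of the generators into `Γ_S`. -/
def gensToGam (x : gens S) : Gam S := ⟨x, Subgroup.subset_closure x.2⟩

theorem lift_gen {p : unram S} (x : PA p.1) :
    ((FreeGroup.lift gensToGam (gen x) : Gam S) : PGL ℚ) = x := by
  simp [gen, gensToGam]

theorem lift_relators {σ : PermFamily S} (hσ : IsSquareFamily σ) :
    ∀ r ∈ relators σ, FreeGroup.lift gensToGam r = 1 := by
  rintro r (⟨p, x, y, u, v, hu, hv, huv, rfl⟩ | ⟨p, l, h, x, y, rfl⟩)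
  · apply Subtype.ext
    rw [map_mul, Subgroup.coe_mul, lift_gen, lift_gen, ← hu, ← hv, cls_star huv, mul_inv_cancel,
      Subgroup.coe_one]
  · apply Subtype.ext
    rw [map_mul, map_inv, map_mul, map_mul, Subgroup.coe_mul, Subgroup.coe_inv, Subgroup.coe_mul,
      Subgroup.coe_mul, lift_gen, lift_gen, lift_gen, lift_gen, hσ p l h x y, mul_inv_cancel,
      Subgroup.coe_one]

/-- The homomorphism from the presented group to `Γ_S`. -/
def presentedToGam {σ : PermFamily S} (hσ : IsSquareFamily σ) :
    PresentedGroup (relators σ) →* Gam S :=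
  PresentedGroup.toGroup (lift_relators hσ)

theorem presentedToGam_of {σ : PermFamily S} (hσ : IsSquareFamily σ) (x : gens S) :
    presentedToGam hσ (PresentedGroup.of x) = gensToGam x :=
  PresentedGroup.toGroup.of _

theorem presentedToGam_letter {σ : PermFamily S} (hσ : IsSquareFamily σ) (a : Letter S) :
    (presentedToGam hσ (letter σ a) : PGL ℚ) = a.2 :=
  congrArg Subtype.val (presentedToGam_of hσ _)

theorem word_cons (σ : PermFamily S) (a : Letter S) (l : List (Letter S)) :
    word σ (a :: l) = letter σ a * word σ l := by simp [word]

theorem word_append (σ : PermFamily S) (l l' : List (Letter S)) :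
    word σ (l ++ l') = word σ l * word σ l' := by simp [word]

/-- The inverse of a class is the class of the conjugate of any representative, so every inverse
pair is covered by an inverse relator. -/
theorem letter_mul_letter_eq_one (σ : PermFamily S) {p : unram S} {x y : PA p.1}
    (h : (x : PGL ℚ) * y = 1) : letter σ ⟨p, x⟩ * letter σ ⟨p, y⟩ = 1 := by
  obtain ⟨u, hu⟩ := cls_surjective (x : PGL ℚ)
  have hu0 : star (u : ℍ[ℚ]) ≠ 0 := star_ne_zero.2 u.ne_zero
  have hv : cls (Units.mk0 _ hu0) = (y : PGL ℚ) := by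
    rw [cls_star (u := u) rfl, hu, inv_eq_iff_mul_eq_one, h]
  exact PresentedGroup.one_of_mem (Or.inl ⟨p, x, y, u, Units.mk0 _ hu0, hu, hv, rfl, rfl⟩)

theorem letter_square (σ : PermFamily S) {p l : unram S} (h : p ≠ l) (x : PA p.1) (y : PA l.1) :
    letter σ ⟨p, x⟩ * letter σ ⟨l, σ p l h x y⟩ = letter σ ⟨l, y⟩ * letter σ ⟨p, σ l p h.symm y x⟩ := by
  have : PresentedGroup.mk (relators σ)
      ((gen x * gen (σ p l h x y)) * (gen y * gen (σ l p h.symm y x))⁻¹) = 1 :=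
    PresentedGroup.one_of_mem (Or.inr ⟨p, l, h, x, y, rfl⟩)
  rwa [map_mul, map_inv, mul_inv_eq_one, map_mul, map_mul] at this

/-- As the map attached to `y` is a permutation, every product `y * x` occurs as one side of a
square relator. -/
theorem letter_swap (σ : PermFamily S) {p l : unram S} (h : p ≠ l) (x : PA p.1) (y : PA l.1) :
    ∃ (x' : PA p.1) (y' : PA l.1),
      letter σ ⟨l, y⟩ * letter σ ⟨p, x⟩ = letter σ ⟨p, x'⟩ * letter σ ⟨l, y'⟩ := by
  refine ⟨(σ l p h.symm y).symm x, σ p l h ((σ l p h.symm y).symm x) y, ?_⟩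
  rw [letter_square σ h, Equiv.apply_symm_apply]

/-- The word of a list of letters with the same prime. -/
def monoWord (p : unram S) (l : List (PA p.1)) : List (Letter S) := l.map (Sigma.mk p)

theorem letter_mul_monoWord (σ : PermFamily S) {p : unram S} (a : Letter S) (h : p ≠ a.1)
    (l : List (PA p.1)) : ∃ (l' : List (PA p.1)) (a' : Letter S), l'.length = l.length ∧ p ≠ a'.1 ∧
      letter σ a * word σ (monoWord p l) = word σ (monoWord p l') * letter σ a' := by
  induction l generalizing a with
  | nil => exact ⟨[], a, rfl, h, by simp [monoWord, word]⟩
  | cons x l ih =>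
    obtain ⟨x', y', hxy⟩ := letter_swap σ h x a.2
    obtain ⟨l', a', hl, ha, e⟩ := ih ⟨a.1, y'⟩ h
    refine ⟨x' :: l', a', by simp [hl], ha, ?_⟩
    have h1 : word σ (monoWord p (x :: l)) = letter σ ⟨p, x⟩ * word σ (monoWord p l) :=
      word_cons _ _ _
    have h2 : word σ (monoWord p (x' :: l')) = letter σ ⟨p, x'⟩ * word σ (monoWord p l') :=
      word_cons _ _ _
    rw [h1, h2, ← mul_assoc, hxy, mul_assoc, e, mul_assoc]

/-- The letters of a given prime can be moved to the front of a word. -/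
theorem exists_word_eq_monoWord_append (σ : PermFamily S) (p : unram S) (l : List (Letter S)) :
    ∃ (l₁ : List (PA p.1)) (l₂ : List (Letter S)), l₁.length + l₂.length = l.length ∧
      (∀ a ∈ l₂, p ≠ a.1) ∧ word σ l = word σ (monoWord p l₁ ++ l₂) := by
  induction l with
  | nil => exact ⟨[], [], rfl, by simp, rfl⟩
  | cons a l ih =>
    obtain ⟨l₁, l₂, hlen, hl₂, e⟩ := ih
    by_cases h : p = a.1
    · obtain ⟨q, x⟩ := a
      dsimp only at h
      subst h
      refine ⟨x :: l₁, l₂, by simp; omega, hl₂, ?_⟩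
      rw [word_cons, e]
      exact (word_cons _ _ _).symm
    · obtain ⟨l', a', hl', ha', e'⟩ := letter_mul_monoWord σ a h l₁
      refine ⟨l', a' :: l₂, by simp; omega, ?_, ?_⟩
      · simpa using ⟨ha', hl₂⟩
      · rw [word_cons, e, word_append, ← mul_assoc, e', word_append, word_cons, mul_assoc]

/-- Positive words suffice because each `PA_p` is closed under inversion. -/
theorem exists_word_eq (σ : PermFamily S) (g : PresentedGroup (relators σ)) :
    ∃ l : List (Letter S), word σ l = g := by
  induction g using PresentedGroup.induction_on with
  | _ z =>
  induction z using FreeGroup.induction_on with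
  | C1 => exact ⟨[], by simp [word]⟩
  | of x =>
    obtain ⟨x, hx⟩ := x
    obtain ⟨p, hp, hxp⟩ := Set.mem_iUnion₂.1 hx
    exact ⟨[⟨⟨p, hp⟩, ⟨x, hxp⟩⟩], (word_cons _ _ _).trans (mul_one _)⟩
  | inv_of x _ =>
    obtain ⟨x, hx⟩ := x
    obtain ⟨p, hp, hxp⟩ := Set.mem_iUnion₂.1 hx
    have h := letter_mul_letter_eq_one σ (p := ⟨p, hp⟩) (x := ⟨x, hxp⟩)
      (y := ⟨x⁻¹, inv_mem_PA (odd_of_mem_unram ⟨p, hp⟩) hxp⟩) (mul_inv_cancel x)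
    refine ⟨[⟨⟨p, hp⟩, ⟨x⁻¹, inv_mem_PA (odd_of_mem_unram ⟨p, hp⟩) hxp⟩⟩], ?_⟩
    rw [map_inv, eq_comm, inv_eq_iff_mul_eq_one, word_cons]
    exact (congrArg (letter σ ⟨⟨p, hp⟩, ⟨x, hxp⟩⟩ * ·) (mul_one _)).trans h
  | mul x y hx hy =>
    obtain ⟨l, hl⟩ := hx
    obtain ⟨l', hl'⟩ := hy
    exact ⟨l ++ l', by rw [word_append, hl, hl', map_mul]⟩

theorem exists_lift (S : Finset Nat.Primes) : ∃ r : Letter S → ℍ[ℚ]ˣ, ∀ a, cls (r a) = (a.2 : PGL ℚ) ∧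
    (r a : ℍ[ℚ]) ∈ oneModTwo ∧ Quaternion.normSq (r a : ℍ[ℚ]) = ((a.1.1 : ℕ) : ℚ) := by
  choose r hr using fun a : Letter S => exists_rep_of_mem_PA (odd_of_mem_unram a.1) a.2.2
  exact ⟨r, hr⟩

theorem presentedToGam_word {σ : PermFamily S} (hσ : IsSquareFamily σ) {r : Letter S → ℍ[ℚ]ˣ}
    (hr : ∀ a, cls (r a) = (a.2 : PGL ℚ)) (l : List (Letter S)) :
    (presentedToGam hσ (word σ l) : PGL ℚ) = cls (l.map r).prod := by
  induction l with
  | nil => simp [word]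
  | cons a l ih =>
    rw [word_cons, map_mul, Subgroup.coe_mul, ih, presentedToGam_letter, List.map_cons,
      List.prod_cons, map_mul, hr]

theorem coe_prod_mem_oneModTwo {r : Letter S → ℍ[ℚ]ˣ} (hr : ∀ a, (r a : ℍ[ℚ]) ∈ oneModTwo)
    (l : List (Letter S)) : (((l.map r).prod : ℍ[ℚ]ˣ) : ℍ[ℚ]) ∈ oneModTwo := by
  induction l with
  | nil => simp
  | cons a l ih =>
    rw [List.map_cons, List.prod_cons, Units.val_mul]
    exact mul_mem (hr a) ih

theorem exists_normSq_prod_eq {r : Letter S → ℍ[ℚ]ˣ}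
    (hr : ∀ a, Quaternion.normSq (r a : ℍ[ℚ]) = ((a.1.1 : ℕ) : ℚ)) (p : unram S)
    (l : List (Letter S)) (hl : ∀ a ∈ l, p ≠ a.1) :
    ∃ m : ℕ, Nat.Coprime p.1 m ∧ Quaternion.normSq (((l.map r).prod : ℍ[ℚ]ˣ) : ℍ[ℚ]) = m := by
  induction l with
  | nil => exact ⟨1, by simp, by simp⟩
  | cons a l ih =>
    obtain ⟨m, hm, h⟩ := ih fun b hb => hl b (List.mem_cons_of_mem _ hb)
    refine ⟨a.1.1 * m, Nat.Coprime.mul_right ((Nat.coprime_primes p.1.2 a.1.1.2).2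
      (coe_ne_of_ne (hl a List.mem_cons_self))) hm, ?_⟩
    rw [List.map_cons, List.prod_cons, Units.val_mul, map_mul, hr, h, Nat.cast_mul]

/-- A word with a nonempty reduced block of letters at `p`, followed by letters at other primes, has
nontrivial image. -/
theorem presentedToGam_reduced_ne_one {σ : PermFamily S} (hσ : IsSquareFamily σ) (p : unram S)
    (x : PA p.1) (l₁ : List (PA p.1)) (l₂ : List (Letter S)) (hl₂ : ∀ a ∈ l₂, p ≠ a.1)
    (hc : (x :: l₁).IsChain fun x y : PA p.1 => (x : PGL ℚ) * y ≠ 1) :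
    presentedToGam hσ (word σ (monoWord p (x :: l₁) ++ l₂)) ≠ 1 := by
  intro h1
  obtain ⟨r, hr⟩ := exists_lift S
  have hrC := fun a => (hr a).2.1
  have hrN := fun a => (hr a).2.2
  have h2 := congrArg Subtype.val h1
  rw [presentedToGam_word hσ (fun a => (hr a).1), Subgroup.coe_one, ← map_one cls, eq_comm] at h2
  obtain ⟨q, hq⟩ := cls_eq_iff.1 h2
  rw [Units.val_one, one_mul] at hq
  have hXC := coe_prod_mem_oneModTwo hrC (monoWord p (x :: l₁) ++ l₂)
  have hUC := coe_prod_mem_oneModTwo hrC (monoWord p (x :: l₁))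
  have hWC := coe_prod_mem_oneModTwo hrC l₂
  obtain ⟨m, hm, hWn⟩ := exists_normSq_prod_eq hrN p l₂ hl₂
  obtain ⟨n, hn⟩ := exists_normSq_eq_natCast
    (mem_hurwitz_of_mem_oneModTwo (coe_prod_mem_oneModTwo hrC (monoWord p l₁ ++ l₂)))
  have hX : Quaternion.normSq ((((monoWord p (x :: l₁) ++ l₂).map r).prod : ℍ[ℚ]ˣ) : ℍ[ℚ]) =
      (p.1 * n : ℕ) := by
    have : monoWord p (x :: l₁) ++ l₂ = ⟨p, x⟩ :: (monoWord p l₁ ++ l₂) := rfl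
    rw [this, List.map_cons, List.prod_cons, Units.val_mul, map_mul, hn, hrN, Nat.cast_mul]
  -- Trivial image means that the product is scalar; its norm contains the factor `p` of the first
  -- letter, so `p` divides the product, and then the block at `p`, since the tail has norm prime to
  -- `p`.
  obtain ⟨z, hz, hXz⟩ := dvd_of_eq_algebraMap p.1.2 hXC hq hX (dvd_mul_right _ _)
  rw [List.map_append, List.prod_append, Units.val_mul] at hXz
  obtain ⟨y, hy, hUy⟩ := dvd_of_dvd_mul hm (mem_hurwitz_of_mem_oneModTwo hUC)
    (mem_hurwitz_of_mem_oneModTwo hWC) hWn hz hXz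
  let ρ : PA p.1 → ℍ[ℚ] := fun a => r ⟨p, a⟩
  have hprod : ((((monoWord p (x :: l₁)).map r).prod : ℍ[ℚ]ˣ) : ℍ[ℚ]) = ((x :: l₁).map ρ).prod := by
    rw [← Units.coeHom_apply, map_list_prod, monoWord, List.map_map, List.map_map]
    rfl
  refine not_dvd_prod_of_isChain p.1.2 (odd_of_mem_unram p) ((x :: l₁).map ρ) ?_ ?_
    ⟨y, hy, hprod ▸ hUy⟩
  · intro w hw
    obtain ⟨a, -, rfl⟩ := List.mem_map.1 hw
    exact ⟨hrC _, hrN _⟩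
  · rw [List.isChain_map]
    refine hc.imp fun a b hab => ?_
    by_contra hcon
    rw [not_and_or, not_not, not_not] at hcon
    apply hab
    have : cls (star (r ⟨p, a⟩)) = cls (r ⟨p, b⟩) := cls_eq_of_eq_or_eq_neg hcon
    rw [cls_star rfl, (hr _).1, (hr _).1] at this
    rw [← this, mul_inv_cancel]

/-- Induction on length: collect the letters at the prime of the first letter. The block cannot be
reduced, and cancelling an inverse pair in it removes two letters. -/
theorem word_eq_one_of_presentedToGam_eq_one {σ : PermFamily S} (hσ : IsSquareFamily σ) (n : ℕ) :
    ∀ l : List (Letter S), l.length = n → presentedToGam hσ (word σ l) = 1 → word σ l = 1 := by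
  induction n using Nat.strong_induction_on with
  | _ n ih =>
  intro l hl h
  cases l with
  | nil => simp [word]
  | cons a t =>
    obtain ⟨p, x⟩ := a
    obtain ⟨l₁, l₂, hlen, hl₂, e⟩ := exists_word_eq_monoWord_append σ p t
    have e' : word σ (⟨p, x⟩ :: t) = word σ (monoWord p (x :: l₁) ++ l₂) := by
      rw [word_cons, e]
      exact (word_cons _ _ _).symm
    rw [e'] at h ⊢
    by_cases hc : (x :: l₁).IsChain fun x y : PA p.1 => (x : PGL ℚ) * y ≠ 1
    · exact absurd h (presentedToGam_reduced_ne_one hσ p x l₁ l₂ hl₂ hc)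
    · rw [List.isChain_iff_forall_rel_of_append_cons_cons] at hc
      push Not at hc
      obtain ⟨a, b, m₁, m₂, hm, hab⟩ := hc
      have e'' : word σ (monoWord p (x :: l₁) ++ l₂) =
          word σ (monoWord p (m₁ ++ m₂) ++ l₂) := by
        rw [hm]
        simp only [monoWord, List.map_append, List.map_cons, word_append, word_cons]
        rw [← mul_assoc (letter σ _), letter_mul_letter_eq_one σ hab, one_mul]
      have hlen' := congrArg List.length hm
      rw [e''] at h ⊢
      refine ih _ ?_ _ rfl h
      simp [monoWord] at hlen' hl ⊢
      omega

theorem presentedToGam_bijective {σ : PermFamily S} (hσ : IsSquareFamily σ) :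
    Function.Bijective (presentedToGam hσ) := by
  constructor
  · rw [injective_iff_map_eq_one]
    intro g hg
    obtain ⟨l, rfl⟩ := exists_word_eq σ g
    exact word_eq_one_of_presentedToGam_eq_one hσ _ l rfl hg
  · have hle : Gam S ≤ (presentedToGam hσ).range.map (Gam S).subtype := by
      refine (Subgroup.closure_le _).2 fun x hx => ?_
      exact ⟨gensToGam ⟨x, hx⟩, ⟨PresentedGroup.of ⟨x, hx⟩, presentedToGam_of hσ _⟩, rfl⟩
    rintro ⟨g, hg⟩
    obtain ⟨_, ⟨y, rfl⟩, hy⟩ := hle hg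
    exact ⟨y, Subtype.ext hy⟩

theorem exists_presentation_equiv {σ : PermFamily S} (hσ : IsSquareFamily σ) :
    ∃ e : PresentedGroup (inverseRelators S ∪ squareRelators σ) ≃* Gam S,
      ∀ x : gens S, (e (PresentedGroup.of x) : PGL ℚ) = x :=
  ⟨MulEquiv.ofBijective _ (presentedToGam_bijective hσ),
    fun x => congrArg Subtype.val (presentedToGam_of hσ x)⟩

end presentation

/-! ### `Γ_S` inside `Λ_S` -/

theorem extend_self (x : ℍ[ℚ]) : extend ℚ x = x := by
  ext <;> simp [extend]

theorem algebraMap_mem_hurwitz {R K : Type*} [CommRing R] [Field K] [CharZero K] [Algebra R K]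
    (r : R) : algebraMap K ℍ[K] (algebraMap R K r) ∈ hurwitz R K := by
  refine ⟨r, 0, 0, 0, ?_⟩
  ext <;> simp

theorem Gam_le_Lam (S : Finset Nat.Primes) : Gam S ≤ Lam S := by
  refine (Subgroup.closure_le _).2 fun x hx => ?_
  obtain ⟨p, hp, u, ⟨huO, hun, -⟩, rfl⟩ := Set.mem_iUnion₂.1 hx
  have hpS : p ∈ S := (Finset.mem_erase.1 hp).2
  have hu : (u : ℍ[ℚ]) ∈ hurwitz (ZS S) ℚ := by
    simpa [extend_self] using extend_mem_hurwitz (R := ZS S) (K := ℚ) huO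
  have hpi : (((p : ℕ) : ℚ))⁻¹ ∈ ZS S := Subring.subset_closure ⟨p, hpS, rfl⟩
  -- The inverse is `star u / p`, and `p` is invertible in `ℤ_S`.
  have hinv : ((u⁻¹ : ℍ[ℚ]ˣ) : ℍ[ℚ]) =
      star (u : ℍ[ℚ]) * algebraMap ℚ ℍ[ℚ] (algebraMap (ZS S) ℚ ⟨_, hpi⟩) := by
    refine Units.inv_eq_of_mul_eq_one_right ?_
    rw [← mul_assoc, Quaternion.self_mul_star, hun]
    have h1 : (((p : ℕ) : ℚ)) * ((p : ℕ) : ℚ)⁻¹ = 1 :=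
      mul_inv_cancel₀ (by exact_mod_cast p.2.ne_zero)
    exact (Quaternion.coe_mul _ _).symm.trans (congrArg _ h1)
  have hu' : ((u⁻¹ : ℍ[ℚ]ˣ) : ℍ[ℚ]) ∈ hurwitz (ZS S) ℚ := by
    rw [hinv]
    exact mul_mem (star_mem_hurwitz hu) (algebraMap_mem_hurwitz _)
  exact ⟨u, ⟨⟨⟨u, hu⟩, ⟨_, hu'⟩, Subtype.ext u.mul_inv, Subtype.ext u.inv_mul⟩, Units.ext rfl⟩, rfl⟩

/-! ### Representatives of the elements of `Γ_S` -/

/-- The norms of the representatives of elements of `Γ_S`. -/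
def normMonoid (S : Finset Nat.Primes) : Submonoid ℕ :=
  Submonoid.closure {n | ∃ p ∈ unram S, n = p}

/-- Conjugates represent inverses, so no denominators are ever needed. -/
theorem exists_rep_of_mem_Gam {S : Finset Nat.Primes} {g : PGL ℚ} (hg : g ∈ Gam S) :
    ∃ u : ℍ[ℚ]ˣ, cls u = g ∧ (u : ℍ[ℚ]) ∈ oneModTwo ∧
      ∃ n ∈ normMonoid S, Quaternion.normSq (u : ℍ[ℚ]) = n := by
  induction hg using Subgroup.closure_induction with
  | mem x hx =>
    obtain ⟨p, hp, hx⟩ := Set.mem_iUnion₂.1 hx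
    obtain ⟨u, hu, huC, hun⟩ := exists_rep_of_mem_PA (odd_of_mem_unram ⟨p, hp⟩) hx
    exact ⟨u, hu, huC, p, Submonoid.subset_closure ⟨p, hp, rfl⟩, hun⟩
  | one => exact ⟨1, map_one _, one_mem _, 1, one_mem _, by simp⟩
  | mul x y _ _ hx hy =>
    obtain ⟨u, rfl, hu, n, hn, hun⟩ := hx
    obtain ⟨v, rfl, hv, m, hm, hvm⟩ := hy
    exact ⟨u * v, map_mul _ _ _, mul_mem hu hv, n * m, mul_mem hn hm, by simp [hun, hvm]⟩
  | inv x _ hx =>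
    obtain ⟨u, rfl, hu, n, hn, hun⟩ := hx
    exact ⟨star u, cls_star rfl, star_mem_oneModTwo hu, n, hn, by simpa using hun⟩

theorem prime_dvd_normMonoid {S : Finset Nat.Primes} {n : ℕ} (hn : n ∈ normMonoid S)
    {q : ℕ} (hq : q.Prime) (h : q ∣ n) : ∃ p : unram S, (p.1 : ℕ) = q := by
  induction hn using Submonoid.closure_induction with
  | mem x hx =>
    obtain ⟨p, hp, rfl⟩ := hx
    exact ⟨⟨p, hp⟩, ((Nat.prime_dvd_prime_iff_eq hq p.2).1 h).symm⟩
  | one => exact absurd (Nat.dvd_one.1 h) hq.ne_one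
  | mul x y _ _ hx hy =>
    rcases hq.dvd_mul.1 h with h | h
    exacts [hx h, hy h]

theorem ne_zero_of_mem_normMonoid {S : Finset Nat.Primes} {n : ℕ} (hn : n ∈ normMonoid S) :
    n ≠ 0 := by
  induction hn using Submonoid.closure_induction with
  | mem x hx =>
    obtain ⟨p, hp, rfl⟩ := hx
    exact p.2.ne_zero
  | one => exact one_ne_zero
  | mul x y _ _ hx hy => exact mul_ne_zero hx hy

/-- Either congruence passes to products; what is needed later is only that `n` is not the norm of a
pure quaternion with odd coordinates. -/
theorem mod_eight_of_mem_normMonoid {S : Finset Nat.Primes}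
    (h : (∀ p ∈ unram S, (p : ℕ) ≡ 1 [MOD 4]) ∨
      (∀ p ∈ unram S, (p : ℕ) ≡ 1 [MOD 8] ∨ (p : ℕ) ≡ 7 [MOD 8])) {n : ℕ}
    (hn : n ∈ normMonoid S) : n % 2 = 1 ∧ n % 8 ≠ 3 := by
  rcases h with h | h
  · have : n % 4 = 1 := by
      induction hn using Submonoid.closure_induction with
      | mem x hx =>
        obtain ⟨p, hp, rfl⟩ := hx
        exact h p hp
      | one => rfl
      | mul x y _ _ hx hy => rw [Nat.mul_mod, hx, hy]
    omega
  · have : n % 8 = 1 ∨ n % 8 = 7 := by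
      induction hn using Submonoid.closure_induction with
      | mem x hx =>
        obtain ⟨p, hp, rfl⟩ := hx
        exact h p hp
      | one => exact Or.inl rfl
      | mul x y _ _ hx hy =>
        rw [Nat.mul_mod]
        rcases hx with hx | hx <;> rcases hy with hy | hy <;> simp [hx, hy]
    omega

/-- An element whose square has integral normalised trace is trivial. -/
theorem cls_eq_one_of_trace_integral {u : ℍ[ℚ]ˣ} (hu : (u : ℍ[ℚ]) ∈ oneModTwo) {n : ℕ}
    (hn : Quaternion.normSq (u : ℍ[ℚ]) = n) (hn2 : n % 2 = 1) (hn8 : n % 8 ≠ 3) {k : ℤ}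
    (hk : 4 * (u : ℍ[ℚ]).re ^ 2 = k * n) : cls u = 1 := by
  obtain ⟨a, b, c, d, h0, h1, h2, h3⟩ := exists_coords_of_mem_oneModTwo hu
  rw [Quaternion.normSq_def'] at hn
  have hn' := hn
  rw [h0, h1, h2, h3] at hn'
  rw [h0] at hk
  have hnz : (1 + 2 * a + d) ^ 2 + (2 * b + d) ^ 2 + (2 * c + d) ^ 2 + d ^ 2 = (n : ℤ) := by
    exact_mod_cast hn'
  have hkz : 4 * (1 + 2 * a + d) ^ 2 = k * (n : ℤ) := by exact_mod_cast hk
  have hpos : 0 < (n : ℤ) := by omega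
  -- The real part satisfies `re² ≤ n`, so `0 ≤ k ≤ 4`; as `n` is odd, `4 ∣ k`.
  have hk0 : 0 ≤ k := by
    by_contra hneg
    nlinarith [sq_nonneg (1 + 2 * a + d)]
  have hk4 : k ≤ 4 := by
    by_contra hneg
    nlinarith [sq_nonneg (2 * b + d), sq_nonneg (2 * c + d), sq_nonneg d]
  generalize hX : (1 + 2 * a + d) ^ 2 = X at hkz hnz
  interval_cases k
  · exfalso
    -- Vanishing real part makes `d` odd, hence all three imaginary coordinates odd. Odd squares are
    -- `1` modulo `8`, so `n ≡ 3`.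
    have hX0 : X = 0 := by omega
    rw [hX0] at hX
    have := pow_eq_zero_iff (two_ne_zero) |>.1 hX
    obtain ⟨e, rfl⟩ : ∃ e, d = 2 * e + 1 := ⟨d / 2, by omega⟩
    have key : ∀ z : ℤ, ∃ w, (2 * z + 1) ^ 2 = 8 * w + 1 := by
      intro z
      obtain ⟨w, hw⟩ := Int.even_mul_succ_self z
      exact ⟨w, by linear_combination 4 * hw⟩
    obtain ⟨w1, hw1⟩ := key (b + e)
    obtain ⟨w2, hw2⟩ := key (c + e)
    obtain ⟨w3, hw3⟩ := key e
    have : (n : ℤ) = 8 * (w1 + w2 + w3) + 3 := by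
      rw [← hnz, hX0]
      linear_combination hw1 + hw2 + hw3
    omega
  · omega
  · omega
  · omega
  · have hXn : X = n := by omega
    have e1 : (2 * b + d) ^ 2 = 0 := by nlinarith [sq_nonneg (2 * b + d), sq_nonneg (2 * c + d), sq_nonneg d]
    have e2 : (2 * c + d) ^ 2 = 0 := by nlinarith [sq_nonneg (2 * b + d), sq_nonneg (2 * c + d), sq_nonneg d]
    have e3 : d ^ 2 = 0 := by nlinarith [sq_nonneg (2 * b + d), sq_nonneg (2 * c + d), sq_nonneg d]
    rw [pow_eq_zero_iff two_ne_zero] at e1 e2 e3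
    rw [e1, Int.cast_zero] at h1
    rw [e2, Int.cast_zero] at h2
    rw [e3, Int.cast_zero] at h3
    have hre : (u : ℍ[ℚ]).re ≠ 0 := by
      intro h
      apply u.ne_zero
      ext <;> simp [h, h1, h2, h3]
    rw [eq_comm, ← map_one (cls (K := ℚ)), cls_eq_iff]
    refine ⟨Units.mk0 _ hre, ?_⟩
    ext <;> simp [h1, h2, h3]

/-- The denominator of `q` divides `n`, so integrality at the primes dividing `n` is enough. -/
theorem exists_int_eq_of_norm_le_one {q : ℚ} {n : ℕ} {m : ℤ} (hn : n ≠ 0) (hq : q * n = m)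
    (h : ∀ (p : ℕ) [Fact p.Prime], p ∣ n → ‖(q : ℚ_[p])‖ ≤ 1) : ∃ k : ℤ, q = k := by
  have hden : q.den ∣ n := by
    have : q = Rat.divInt m n := by
      rw [Rat.divInt_eq_div, ← hq]
      push_cast
      field_simp
    rw [this]
    exact_mod_cast Rat.den_dvd m n
  suffices q.den = 1 from ⟨q.num, (Rat.coe_int_num_of_den_eq_one this).symm⟩
  by_contra hne
  obtain ⟨p, hp, hpd⟩ := Nat.exists_prime_and_dvd hne
  have : Fact p.Prime := ⟨hp⟩
  have h1 := h p (hpd.trans hden)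
  have h2 : (q : ℚ_[p]) * (q.den : ℚ_[p]) = (q.num : ℚ_[p]) := by
    exact_mod_cast congrArg (Rat.cast (K := ℚ_[p])) (Rat.mul_den_eq_num q)
  have h3 : ‖(q.den : ℚ_[p])‖ < 1 := by
    have := (Padic.norm_intCast_lt_one_iff (p := p) (k := (q.den : ℤ))).2 (by exact_mod_cast hpd)
    exact_mod_cast this
  have h4 : ‖(q.num : ℚ_[p])‖ < 1 := by
    rw [← h2, norm_mul]
    exact mul_lt_one_of_nonneg_of_lt_one_right h1 (norm_nonneg _) h3
  have h5 := (Padic.norm_intCast_lt_one_iff (p := p)).1 h4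
  have h6 := Nat.dvd_gcd (Int.natCast_dvd.1 h5) hpd
  rw [q.reduced.gcd_eq_one] at h6
  exact hp.one_lt.ne' (Nat.dvd_one.1 h6)

/-- The common criterion for cells and for torsion. The quantity in `ht` is the trace of `u² / n`,
an element of norm one; only primes of `S₀` can divide its denominator. -/
theorem eq_one_of_mem_Gam {S : Finset Nat.Primes}
    (h : (∀ p ∈ unram S, (p : ℕ) ≡ 1 [MOD 4]) ∨
      (∀ p ∈ unram S, (p : ℕ) ≡ 1 [MOD 8] ∨ (p : ℕ) ≡ 7 [MOD 8])) {u : ℍ[ℚ]ˣ} {n : ℕ}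
    (hu : (u : ℍ[ℚ]) ∈ oneModTwo) (hn : n ∈ normMonoid S)
    (hun : Quaternion.normSq (u : ℍ[ℚ]) = n)
    (ht : ∀ p : unram S, ‖((4 * (u : ℍ[ℚ]).re ^ 2 / n - 2 : ℚ) : ℚ_[(p.1 : ℕ)])‖ ≤ 1) :
    cls u = 1 := by
  have hn0 : (n : ℚ) ≠ 0 := by exact_mod_cast ne_zero_of_mem_normMonoid hn
  obtain ⟨hn2, hn8⟩ := mod_eight_of_mem_normMonoid h hn
  obtain ⟨a, b, c, d, h0, -⟩ := exists_coords_of_mem_oneModTwo hu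
  obtain ⟨k, hk⟩ : ∃ k : ℤ, (4 * (u : ℍ[ℚ]).re ^ 2 / n - 2 : ℚ) = k := by
    refine exists_int_eq_of_norm_le_one (m := 4 * (1 + 2 * a + d) ^ 2 - 2 * n)
      (ne_zero_of_mem_normMonoid hn) ?_ ?_
    · rw [h0]
      push_cast
      field_simp
    · intro q hq hqn
      obtain ⟨p, rfl⟩ := prime_dvd_normMonoid hn hq.out hqn
      exact ht p
  refine cls_eq_one_of_trace_integral hu hun hn2 hn8 (k := k + 2) ?_
  push_cast
  rw [← hk]
  field_simp
  ring

/-! ### Vertex stabilisers -/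

theorem norm_normSq_unit {p : ℕ} [Fact p.Prime] (w : (hurwitz ℤ_[p] ℚ_[p])ˣ) :
    ‖Quaternion.normSq (w : ℍ[ℚ_[p]])‖ = 1 := by
  have h2 := norm_normSq_le (w : hurwitz ℤ_[p] ℚ_[p]).2
  have h3 := norm_normSq_le ((w⁻¹ : (hurwitz ℤ_[p] ℚ_[p])ˣ) : hurwitz ℤ_[p] ℚ_[p]).2
  have h4 : ‖Quaternion.normSq (w : ℍ[ℚ_[p]])‖ *
      ‖Quaternion.normSq (((w⁻¹ : (hurwitz ℤ_[p] ℚ_[p])ˣ) : hurwitz ℤ_[p] ℚ_[p]) : ℍ[ℚ_[p]])‖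
        = 1 := by
    rw [← norm_mul, ← map_mul, ← Subring.coe_mul, Units.mul_inv]
    simp
  nlinarith [norm_nonneg (Quaternion.normSq (w : ℍ[ℚ_[p]]))]

theorem norm_two_mul_re_le_one {p : ℕ} [Fact p.Prime] {x : ℍ[ℚ_[p]]}
    (hx : x ∈ hurwitz ℤ_[p] ℚ_[p]) : ‖2 * x.re‖ ≤ 1 := by
  obtain ⟨a, b, c, d, rfl⟩ := hx
  have : 2 * (hquat (algebraMap ℤ_[p] ℚ_[p] a) (algebraMap ℤ_[p] ℚ_[p] b)
      (algebraMap ℤ_[p] ℚ_[p] c) (algebraMap ℤ_[p] ℚ_[p] d)).re = (a + a + d : ℤ_[p]) := by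
    simp
    ring
  rw [this]
  exact PadicInt.norm_le_one _

theorem re_mul_comm {K : Type*} [Field K] (x y : ℍ[K]) : (x * y).re = (y * x).re := by
  simp only [Quaternion.re_mul]
  ring

/-- Conjugation moves the vertex to the standard one, so a multiple `q` of a conjugate of `u²` is a
unit of `𝒜(ℤ_p)` and has integral trace. Comparing norms shows that `q` equals `1 / n` up to a
`p`-adic unit. -/
theorem norm_trace_le_one_of_fixes {p : ℕ} [Fact p.Prime] {u : ℍ[ℚ]ˣ} {n : ℕ} (hn0 : n ≠ 0)
    (hn : Quaternion.normSq (u : ℍ[ℚ]) = n) (v : TreeVertex p)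
    (hv : loc ℚ_[p] (cls u * cls u) • v = v) :
    ‖((4 * (u : ℍ[ℚ]).re ^ 2 / n - 2 : ℚ) : ℚ_[p])‖ ≤ 1 := by
  obtain ⟨h, rfl⟩ := QuotientGroup.mk_surjective v
  obtain ⟨h, rfl⟩ := cls_surjective h
  set E : ℍ[ℚ_[p]]ˣ := Units.map (extend ℚ_[p] : ℍ[ℚ] →+* ℍ[ℚ_[p]]).toMonoidHom (u * u) with hE
  have hloc : loc ℚ_[p] (cls u * cls u) = cls E := rfl
  have hmem : (cls h)⁻¹ * (cls E * cls h) ∈ PGLA ℤ_[p] ℚ_[p] := by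
    rw [hloc] at hv
    exact QuotientGroup.eq.1 hv.symm
  obtain ⟨_, ⟨w, rfl⟩, hw⟩ := hmem
  rw [← map_mul, ← map_inv, ← map_mul, eq_comm] at hw
  obtain ⟨q, hq⟩ := cls_eq_iff.1 hw
  have hq' : (w : ℍ[ℚ_[p]]) = ((h⁻¹ : ℍ[ℚ_[p]]ˣ) : ℍ[ℚ_[p]]) * ((E : ℍ[ℚ_[p]]) * h) *
      algebraMap ℚ_[p] ℍ[ℚ_[p]] q := hq
  have hEv : (E : ℍ[ℚ_[p]]) = extend ℚ_[p] ((u : ℍ[ℚ]) * (u : ℍ[ℚ])) := rfl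
  have hEre : (E : ℍ[ℚ_[p]]).re = ((2 * (u : ℍ[ℚ]).re ^ 2 - n : ℚ) : ℚ_[p]) := by
    rw [hEv, ← hn, Quaternion.normSq_def']
    simp only [extend, RingHom.coe_mk, MonoidHom.coe_mk, OneHom.coe_mk, quat_re,
      Quaternion.re_mul, eq_ratCast]
    congr 1
    ring
  have hEn : Quaternion.normSq (E : ℍ[ℚ_[p]]) = (n : ℚ_[p]) ^ 2 := by
    have hext : ∀ x : ℍ[ℚ], Quaternion.normSq (extend ℚ_[p] x) =
        ((Quaternion.normSq x : ℚ) : ℚ_[p]) := by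
      intro x
      rw [Quaternion.normSq_def', Quaternion.normSq_def']
      simp [extend]
    rw [hEv, hext, map_mul, hn]
    push_cast
    ring
  have hnq : ‖(n : ℚ_[p])‖ * ‖(q : ℚ_[p])‖ = 1 := by
    have h1 := norm_normSq_unit w
    have h2 : Quaternion.normSq (algebraMap ℚ_[p] ℍ[ℚ_[p]] q) = (q : ℚ_[p]) ^ 2 :=
      Quaternion.normSq_coe _
    have h3 : Quaternion.normSq ((h⁻¹ : ℍ[ℚ_[p]]ˣ) : ℍ[ℚ_[p]]) *
        Quaternion.normSq (h : ℍ[ℚ_[p]]) = 1 := by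
      rw [← map_mul, Units.inv_mul, map_one]
    rw [hq', map_mul, map_mul, map_mul, hEn, h2, mul_left_comm, h3, mul_one, ← mul_pow, norm_pow,
      pow_eq_one_iff_of_nonneg (norm_nonneg _) two_ne_zero, norm_mul] at h1
    exact h1
  have hre : (w : ℍ[ℚ_[p]]).re = (E : ℍ[ℚ_[p]]).re * q := by
    have : ∀ x : ℍ[ℚ_[p]], (x * algebraMap ℚ_[p] ℍ[ℚ_[p]] q).re = x.re * q := by
      intro x
      simp
    rw [hq', this, re_mul_comm, mul_assoc, Units.mul_inv, mul_one]
  have h2 := norm_two_mul_re_le_one (w : hurwitz ℤ_[p] ℚ_[p]).2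
  rw [hre, hEre] at h2
  have hn0' : (n : ℚ_[p]) ≠ 0 := by exact_mod_cast hn0
  have hfin : ((4 * (u : ℍ[ℚ]).re ^ 2 / n - 2 : ℚ) : ℚ_[p]) * (n * q) =
      2 * (((2 * (u : ℍ[ℚ]).re ^ 2 - n : ℚ) : ℚ_[p]) * q) := by
    push_cast
    field_simp
    ring
  rw [← hfin, norm_mul, norm_mul, hnq, mul_one] at h2
  exact h2

/-- Squaring undoes a possible inversion of an edge. -/
theorem exists_fixed_vertex {S : Finset Nat.Primes} {g : PGL ℚ} {c : Cell S} (h : FixesCell g c)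
    (p : unram S) : ∃ v : TreeVertex p.1, loc ℚ_[(p.1 : ℕ)] (g * g) • v = v := by
  have hp := h p
  set γ := loc ℚ_[(p.1 : ℕ)] g with hγ
  have hγγ : ∀ v : TreeVertex p.1, loc ℚ_[(p.1 : ℕ)] (g * g) • v = γ • γ • v := by
    intro v
    rw [map_mul, mul_smul]
  rcases c.isFace p with ⟨v, hv⟩ | ⟨v, w, -, hv⟩
  · rw [hv, Set.image_singleton, Set.singleton_eq_singleton_iff] at hp
    exact ⟨v, by rw [hγγ, hp, hp]⟩
  · rw [hv, Set.image_pair] at hp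
    have h1 : γ • v = v ∨ γ • v = w := by
      have : γ • v ∈ ({v, w} : Set (TreeVertex p.1)) := hp ▸ Set.mem_insert _ _
      simpa using this
    have h2 : γ • w = v ∨ γ • w = w := by
      have : γ • w ∈ ({v, w} : Set (TreeVertex p.1)) :=
        hp ▸ Set.mem_insert_of_mem _ (Set.mem_singleton _)
      simpa using this
    rcases h1 with h1 | h1
    · exact ⟨v, by rw [hγγ, h1, h1]⟩
    · rcases h2 with h2 | h2
      · exact ⟨v, by rw [hγγ, h1, h2]⟩
      · exact ⟨w, by rw [hγγ, h2, h2]⟩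

/-! ### Elements of finite order -/

/-- This is the trace of `w ^ k` times the Cayley–Hamilton identity for `w`. -/
theorem trace_pow_recurrence {w : ℍ[ℚ]} (hw : Quaternion.normSq w = 1) (k : ℕ) :
    2 * (w ^ (k + 2)).re = 2 * w.re * (2 * (w ^ (k + 1)).re) - 2 * (w ^ k).re := by
  rw [pow_succ w (k + 1), pow_succ w k]
  generalize w ^ k = y
  rw [Quaternion.normSq_def'] at hw
  simp only [Quaternion.re_mul, Quaternion.imI_mul, Quaternion.imJ_mul, Quaternion.imK_mul]
  linear_combination -2 * y.re * hw

/-- If the trace of `w` has norm above `1`, the first term of the recurrence strictly dominates, and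
by the ultrametric inequality the norms of the traces increase. -/
theorem norm_trace_pow_gt {p : ℕ} [Fact p.Prime] {w : ℍ[ℚ]} (hw : Quaternion.normSq w = 1)
    (h : 1 < ‖((2 * w.re : ℚ) : ℚ_[p])‖) (k : ℕ) :
    1 < ‖((2 * (w ^ (k + 1)).re : ℚ) : ℚ_[p])‖ ∧
      ‖((2 * (w ^ k).re : ℚ) : ℚ_[p])‖ < ‖((2 * (w ^ (k + 1)).re : ℚ) : ℚ_[p])‖ := by
  induction k with
  | zero =>
    have h2 : ‖((2 : ℤ) : ℚ_[p])‖ ≤ 1 := Padic.norm_int_le_one 2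
    push_cast at h2
    have e : ((2 * (w ^ 0).re : ℚ) : ℚ_[p]) = 2 := by simp
    rw [e, zero_add, pow_one]
    exact ⟨h, h2.trans_lt h⟩
  | succ k ih =>
    have hlt : ‖((2 * (w ^ (k + 1)).re : ℚ) : ℚ_[p])‖ <
        ‖((2 * w.re * (2 * (w ^ (k + 1)).re) : ℚ) : ℚ_[p])‖ := by
      rw [Rat.cast_mul (2 * w.re), norm_mul]
      exact lt_mul_of_one_lt_left (one_pos.trans ih.1) h
    have hkey : ‖((2 * (w ^ (k + 1 + 1)).re : ℚ) : ℚ_[p])‖ =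
        ‖((2 * w.re * (2 * (w ^ (k + 1)).re) : ℚ) : ℚ_[p])‖ := by
      have hne := (ih.2.trans hlt).ne'
      rw [trace_pow_recurrence hw, Rat.cast_sub, sub_eq_add_neg, Padic.add_eq_max_of_ne
        (by rwa [norm_neg]), norm_neg, max_eq_left (ih.2.trans hlt).le]
    rw [hkey]
    exact ⟨ih.1.trans hlt, hlt⟩

/-- For `w = u² / n`, torsion makes some power `w ^ m` a scalar of norm one, that is `±1`, with
integral trace `±2`; this contradicts the growth of traces. No fixed point on the trees is needed.
-/
theorem norm_trace_le_one_of_isOfFinOrder {p : ℕ} [Fact p.Prime] {u : ℍ[ℚ]ˣ} {n : ℕ} (hn0 : n ≠ 0)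
    (hn : Quaternion.normSq (u : ℍ[ℚ]) = n) (h : IsOfFinOrder (cls u)) :
    ‖((4 * (u : ℍ[ℚ]).re ^ 2 / n - 2 : ℚ) : ℚ_[p])‖ ≤ 1 := by
  obtain ⟨m, hm, h⟩ := isOfFinOrder_iff_pow_eq_one.1 h
  have hnq : (n : ℚ) ≠ 0 := by exact_mod_cast hn0
  set w : ℍ[ℚ] := (n : ℚ)⁻¹ • ((u : ℍ[ℚ]) * (u : ℍ[ℚ])) with hw
  have hwn : Quaternion.normSq w = 1 := by
    rw [hw, Quaternion.normSq_smul, map_mul, hn]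
    field_simp
  have hwre : 2 * w.re = 4 * (u : ℍ[ℚ]).re ^ 2 / n - 2 := by
    have : ((u : ℍ[ℚ]) * (u : ℍ[ℚ])).re = 2 * (u : ℍ[ℚ]).re ^ 2 - n := by
      rw [← hn, Quaternion.normSq_def', Quaternion.re_mul]
      ring
    rw [hw, Quaternion.re_smul, this, smul_eq_mul]
    field_simp
    ring
  rw [← hwre]
  by_contra hgt
  rw [not_le] at hgt
  rw [← map_pow, ← map_one (cls (K := ℚ)), eq_comm] at h
  obtain ⟨q, hq⟩ := cls_eq_iff.1 h
  rw [Units.val_one, one_mul, Units.val_pow_eq_pow_val] at hq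
  obtain ⟨c, hc⟩ : ∃ c : ℚ, w ^ m = algebraMap ℚ ℍ[ℚ] c := by
    refine ⟨(n : ℚ)⁻¹ ^ m * (q * q), ?_⟩
    rw [hw, smul_pow, (Commute.refl (u : ℍ[ℚ])).mul_pow, hq, ← map_mul, Algebra.smul_def, ← map_mul]
  have hc2 : c ^ 2 = 1 := by
    have h1 : Quaternion.normSq (algebraMap ℚ ℍ[ℚ] c) = c ^ 2 := Quaternion.normSq_coe _
    rw [← h1, ← hc, map_pow, hwn, one_pow]
  have hre : (w ^ m).re = c := by rw [hc]; rfl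
  have hcz : ∃ z : ℤ, 2 * c = z := by
    rcases sq_eq_one_iff.1 hc2 with h | h
    · exact ⟨2, by rw [h]; norm_num⟩
    · exact ⟨-2, by rw [h]; norm_num⟩
  obtain ⟨z, hz⟩ := hcz
  obtain ⟨m, rfl⟩ := Nat.exists_eq_succ_of_ne_zero hm.ne'
  have := (norm_trace_pow_gt hwn hgt m).1
  rw [hre, hz, Rat.cast_intCast] at this
  exact this.not_ge (Padic.norm_int_le_one z)

end HurwitzLattice

theorem theorem3p11 (S : Finset Nat.Primes) (hS : HurwitzLattice.two ∈ S) :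
    HurwitzLattice.Gam S ≤ HurwitzLattice.Lam S ∧
    (∃! σ : HurwitzLattice.PermFamily S, HurwitzLattice.IsSquareFamily σ) ∧
    (∀ σ : HurwitzLattice.PermFamily S, HurwitzLattice.IsSquareFamily σ →
      ∃ e : PresentedGroup
          (HurwitzLattice.inverseRelators S ∪ HurwitzLattice.squareRelators σ) ≃*
            HurwitzLattice.Gam S,
        ∀ x : HurwitzLattice.gens S,
          (e (PresentedGroup.of x) : HurwitzLattice.PGL ℚ) = x) ∧
    (((∀ p ∈ HurwitzLattice.unram S, (p : ℕ) ≡ 1 [MOD 4]) ∨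
      (∀ p ∈ HurwitzLattice.unram S, (p : ℕ) ≡ 1 [MOD 8] ∨ (p : ℕ) ≡ 7 [MOD 8])) →
      (∀ g ∈ HurwitzLattice.Gam S, g ≠ 1 →
        ∀ c : HurwitzLattice.Cell S, ¬ HurwitzLattice.FixesCell g c) ∧
      (∀ g : HurwitzLattice.Gam S, g ≠ 1 → ¬ IsOfFinOrder g)) := by
  refine ⟨HurwitzLattice.Gam_le_Lam S, HurwitzLattice.existsUnique_squareFamily S,
    fun σ hσ => HurwitzLattice.exists_presentation_equiv hσ, fun h => ⟨?_, ?_⟩⟩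
  · intro g hg hg1 c hc
    obtain ⟨u, rfl, hu, n, hn, hun⟩ := HurwitzLattice.exists_rep_of_mem_Gam hg
    refine hg1 (HurwitzLattice.eq_one_of_mem_Gam h hu hn hun fun p => ?_)
    obtain ⟨v, hv⟩ := HurwitzLattice.exists_fixed_vertex hc p
    exact HurwitzLattice.norm_trace_le_one_of_fixes
      (HurwitzLattice.ne_zero_of_mem_normMonoid hn) hun v hv
  · rintro ⟨g, hg⟩ hg1 hfin
    obtain ⟨u, rfl, hu, n, hn, hun⟩ := HurwitzLattice.exists_rep_of_mem_Gam hg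
    refine hg1 (Subtype.ext (HurwitzLattice.eq_one_of_mem_Gam h hu hn hun fun p => ?_))
    exact HurwitzLattice.norm_trace_le_one_of_isOfFinOrder
      (HurwitzLattice.ne_zero_of_mem_normMonoid hn) hun
      ((HurwitzLattice.Gam S).subtype.isOfFinOrder hfin)
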